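/- Let $X$ be a compact metric space with a fixed dense sequence $(s_j)_{j\in\mathbb N}$ (a computable metric space), and equip $\mathbb R$ and $\mathbb R^m$ (Euclidean norm) with effective enumerations of $\mathbb Q$ and $\mathbb Q^m$ as dense sequences. An oracle for a point $\alpha$ of such a space is a function $\phi:\mathbb N\to\mathbb N$ with $d(\alpha,s_{\phi(k)})<2^{-k}$ for all $k$, where $(s_j)$ is the dense sequence of that space. A function $F:S\to Y$ on a subset $S$ of such a space is computable if a single oracle Turing machine, given any oracle for any $\alpha\in S$ and any $k\in\mathbb N$, outputs the index of a point of the dense sequence of $Y$ at distance less than $2^{-k}$ from $F(\alpha)$; if $F$ also depends on $n\in\mathbb N$, then $n$ is an additional input of that machine. Let $f:X\to X$ be continuous, let $\mathcal M$ be the space of $f$-invariant Borel probability measures with the weak$^*$ topology, let $h_\mu(f)$ be the measure-theoretic entropy of $f$ with respect to $\mu\in\mathcal M$, and suppose that $\mu\mapsto h_\mu(f)$ is upper semi-continuous on $\mathcal M$. For $\Psi\in C(X,\mathbb R^m)$ put $$\mathrm{rv}_\Psi(\mu)=\Big(\int\Psi_1\,d\mu,\dots,\int\Psi_m\,d\mu\Big),\qquad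 \mathrm{Rot}(\Psi)=\{\mathrm{rv}_\Psi(\mu):\mu\in\mathcal M\},$$ $$\mathcal H_\Psi(w)=\sup\{h_\mu(f):\mu\in\mathcal M,\ \mathrm{rv}_\Psi(\mu)=w\}\qquad (w\in\mathrm{Rot}(\Psi)).$$ An equilibrium state of $g\in C(X,\mathbb R)$ is a $\mu\in\mathcal M$ with $h_\mu(f)+\int g\,d\mu=\sup_{\nu\in\mathcal M}\big(h_\nu(f)+\int g\,d\nu\big)$. Let $\Phi\in C(X,\mathbb R^m)$ be computable, and let $r:\mathrm{int}\,\mathrm{Rot}(\Phi)\to(0,\infty)$ be a computable function with $B(w,r(w))\subset\mathrm{Rot}(\Phi)$ for all $w\in\mathrm{int}\,\mathrm{Rot}(\Phi)$. Suppose that there are $\Phi_{\epsilon_n}\in C(X,\mathbb R^m)$ and real numbers $\epsilon_n\to0$ $(n\in\mathbb N)$ with $\|\Phi_{\epsilon_n}-\Phi\|_\infty<\epsilon_n$ for all $n$, such that for all $n\in\mathbb N$ and $v\in\mathbb R^m$ the potential $v\cdot\Phi_{\epsilon_n}$ has a unique equilibrium state $\mu_{v\cdot\Phi_{\epsilon_n}}$,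 and such that the functions $n\mapsto\epsilon_n$, $(v,n)\mapsto h_{\mu_{v\cdot\Phi_{\epsilon_n}}}(f)$ (with finite values) and $(v,n)\mapsto\mathrm{rv}_{\Phi_{\epsilon_n}}(\mu_{v\cdot\Phi_{\epsilon_n}})$ are computable. Then $\mathcal H_\Phi$ is finite and computable on $\mathrm{int}\,\mathrm{Rot}(\Phi)$. -/

import Mathlib

open MeasureTheory Filter Topology Set

/-! ### Oracle machines -/

/-- Programs of oracle machines, presented as codes for partial recursive functionals:
the basic functions, one query instruction to the oracle, pairing, composition, primitive
recursion and unbounded search. A code is a finite object that does not depend on the oracle. -/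
inductive OracleCode : Type
  | zero : OracleCode
  | succ : OracleCode
  | left : OracleCode
  | right : OracleCode
  | query : OracleCode
  | pair : OracleCode → OracleCode → OracleCode
  | comp : OracleCode → OracleCode → OracleCode
  | prec : OracleCode → OracleCode → OracleCode
  | rfind : OracleCode → OracleCode

/-- The partial function computed by a code with access to the oracle `φ`. For a fixed `φ` these
are exactly the functions that are `Nat.RecursiveIn {φ}`. -/
def OracleCode.eval (φ : ℕ → ℕ) : OracleCode → ℕ →. ℕ
  | .zero => fun _ => Part.some 0
  | .succ => fun n => Part.some (n + 1)
  | .left => fun n => Part.some n.unpair.1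
  | .right => fun n => Part.some n.unpair.2
  | .query => fun n => Part.some (φ n)
  | .pair c d => fun n => Nat.pair <$> c.eval φ n <*> d.eval φ n
  | .comp c d => fun n => d.eval φ n >>= c.eval φ
  | .prec c d => fun p =>
      let (a, n) := Nat.unpair p
      n.rec (c.eval φ a) fun y IH => do
        let i ← IH
        d.eval φ (Nat.pair a (Nat.pair y i))
  | .rfind c => fun a => Nat.rfind fun n => (fun m => decide (m = 0)) <$> c.eval φ (Nat.pair a n)

/-! ### Computable metric spaces and computable functions -/

/-- A computable metric space: a metric space with a distinguished dense sequence
(repetitions are allowed, so that finite spaces are included). -/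
class ComputableMetricSpace (X : Type*) [MetricSpace X] where
  /-- the distinguished sequence -/
  seq : ℕ → X
  denseRange_seq : DenseRange seq

/-- `φ` is an oracle for the point `α`: `φ n` names a point at distance less than `2⁻ⁿ`. -/
def IsOracleFor {X : Type*} [MetricSpace X] [ComputableMetricSpace X] (φ : ℕ → ℕ) (α : X) : Prop :=
  ∀ n : ℕ, dist α (ComputableMetricSpace.seq (φ n)) < (1 / 2 : ℝ) ^ n

/-- `F` is computable on `S`: one oracle machine, given any oracle for any `α ∈ S` and given `k`,
halts with the name of a point at distance less than `2⁻ᵏ` from `F α`. -/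
def IsComputableOn {X Y : Type*} [MetricSpace X] [ComputableMetricSpace X]
    [MetricSpace Y] [ComputableMetricSpace Y] (S : Set X) (F : X → Y) : Prop :=
  ∃ c : OracleCode, ∀ α ∈ S, ∀ φ : ℕ → ℕ, IsOracleFor φ α → ∀ k : ℕ,
    ∃ j ∈ c.eval φ k, dist (ComputableMetricSpace.seq j) (F α) < (1 / 2 : ℝ) ^ k

/-- The sequence of functions `(F n)`, that is `(α, n) ↦ F n α`, is computable on `X × ℕ`:
one oracle machine works for all `n`, with `n` as an additional input. -/
def IsComputableFunSeq {X Y : Type*} [MetricSpace X] [ComputableMetricSpace X]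
    [MetricSpace Y] [ComputableMetricSpace Y] (F : ℕ → X → Y) : Prop :=
  ∃ c : OracleCode, ∀ α : X, ∀ φ : ℕ → ℕ, IsOracleFor φ α → ∀ n k : ℕ,
    ∃ j ∈ c.eval φ (Nat.pair n k), dist (ComputableMetricSpace.seq j) (F n α) < (1 / 2 : ℝ) ^ k

/-- The sequence of points `(α n)` is computable. -/
def IsComputablePointSeq {Y : Type*} [MetricSpace Y] [ComputableMetricSpace Y]
    (α : ℕ → Y) : Prop :=
  ∃ ψ : ℕ → ℕ → ℕ, Computable₂ ψ ∧
    ∀ n k : ℕ, dist (α n) (ComputableMetricSpace.seq (ψ n k)) < (1 / 2 : ℝ) ^ k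

/-- The rational number `(a - b) / (d + 1)` with the name `⟨⟨a, b⟩, d⟩`. -/
def ratOfCode (c : ℕ) : ℚ :=
  ((c.unpair.1.unpair.1 : ℚ) - (c.unpair.1.unpair.2 : ℚ)) / ((c.unpair.2 : ℚ) + 1)

/-- The `i`-th entry of the infinite tuple `⟨a₀, ⟨a₁, ⟨a₂, …⟩⟩⟩` named by `c`. -/
def tupleEntry (c i : ℕ) : ℕ := ((fun b : ℕ => b.unpair.2)^[i] c).unpair.1

/-- The point of `ℚᵐ` named by `c`. -/
noncomputable def ratVecOfCode (m : ℕ) (c : ℕ) : EuclideanSpace ℝ (Fin m) :=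
  WithLp.toLp 2 fun i => (ratOfCode (tupleEntry c i) : ℝ)

theorem ratOfCode_surjective : Function.Surjective ratOfCode := by
  intro q
  refine ⟨Nat.pair (Nat.pair q.num.toNat (-q.num).toNat) (q.den - 1), ?_⟩
  have h1 : ((q.num.toNat : ℚ) - ((-q.num).toNat : ℚ)) = (q.num : ℚ) := by
    have : ((q.num.toNat : ℤ) - ((-q.num).toNat : ℤ)) = q.num := by omega
    exact_mod_cast this
  have h2 : (((q.den - 1 : ℕ) : ℚ) + 1) = (q.den : ℚ) := by
    have : (q.den - 1) + 1 = q.den := Nat.succ_pred_eq_of_pos q.den_pos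
    exact_mod_cast this
  simp only [ratOfCode, Nat.unpair_pair]
  rw [h1, h2, Rat.num_div_den]

theorem exists_tupleEntry (m : ℕ) (a : ℕ → ℕ) : ∃ c, ∀ i < m, tupleEntry c i = a i := by
  induction m generalizing a with
  | zero => exact ⟨0, fun i hi => absurd hi (Nat.not_lt_zero i)⟩
  | succ m ih =>
    obtain ⟨c, hc⟩ := ih fun i => a (i + 1)
    refine ⟨Nat.pair (a 0) c, fun i hi => ?_⟩
    cases i with
    | zero => simp [tupleEntry]
    | succ i =>
      have := hc i (by omega)
      simpa [tupleEntry, Function.iterate_succ_apply] using this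

theorem denseRange_ratVecOfCode (m : ℕ) : DenseRange (ratVecOfCode m) := by
  have h1 : DenseRange fun (q : Fin m → ℚ) (i : Fin m) => (q i : ℝ) :=
    DenseRange.piMap fun _ => Rat.denseRange_cast
  have h2 : DenseRange fun q : Fin m → ℚ =>
      (WithLp.toLp 2 fun i => (q i : ℝ) : EuclideanSpace ℝ (Fin m)) :=
    (WithLp.toLp_surjective 2).denseRange.comp h1 (PiLp.continuous_toLp 2 _)
  refine h2.mono ?_
  rintro _ ⟨q, rfl⟩
  choose a ha using fun i => ratOfCode_surjective (q i)
  obtain ⟨c, hc⟩ := exists_tupleEntry m fun i => if h : i < m then a ⟨i, h⟩ else 0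
  refine ⟨c, ?_⟩
  unfold ratVecOfCode
  congr 1
  funext i
  rw [hc i i.2, dif_pos i.2, ha]

noncomputable instance instComputableMetricSpaceReal : ComputableMetricSpace ℝ where
  seq c := (ratOfCode c : ℝ)
  denseRange_seq := Rat.denseRange_cast.comp ratOfCode_surjective.denseRange Rat.continuous_coe_real

noncomputable instance instComputableMetricSpaceEuclidean (m : ℕ) :
    ComputableMetricSpace (EuclideanSpace ℝ (Fin m)) where
  seq := ratVecOfCode m
  denseRange_seq := denseRange_ratVecOfCode m

/-! ### Invariant measures and measure-theoretic entropy -/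

/-- The space of `f`-invariant Borel probability measures, with the weak-* topology. -/
abbrev InvariantMeasure {X : Type*} [MetricSpace X] [MeasurableSpace X] (f : X → X) : Type _ :=
  {μ : ProbabilityMeasure X // MeasurePreserving f (μ : Measure X) (μ : Measure X)}

/-- The Shannon entropy `-∑ μ(A) log μ(A)` of the finite partition into the fibres of `P`. -/
noncomputable def partitionEntropy {X α : Type*} [MeasurableSpace X] [Fintype α]
    (μ : Measure X) (P : X → α) : ℝ :=
  ∑ a : α, Real.negMulLog (μ.real (P ⁻¹' {a}))

/-- The labelling whose fibres form the join of `P, f⁻¹P, …, f⁻⁽ⁿ⁻¹⁾P`. -/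
def itinerary {X : Type*} {k : ℕ} (f : X → X) (P : X → Fin k) (n : ℕ) (x : X) : Fin n → Fin k :=
  fun i => P (f^[i] x)

/-- The entropy `h_μ(f, P) = lim (1/n) H_μ(P ∨ f⁻¹P ∨ … ∨ f⁻⁽ⁿ⁻¹⁾P)` of `f` relative to a finite
partition. For an invariant measure the limit exists by subadditivity, hence equals the `liminf`. -/
noncomputable def entropyOfPartition {X : Type*} [MeasurableSpace X] {k : ℕ}
    (f : X → X) (μ : Measure X) (P : X → Fin k) : EReal :=
  liminf (fun n : ℕ => ((partitionEntropy μ (itinerary f P n) / n : ℝ) : EReal)) atTop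

/-- The measure-theoretic (Kolmogorov–Sinai) entropy `h_μ(f) ∈ [0, ∞]`: the supremum over all
finite measurable partitions. -/
noncomputable def metricEntropy {X : Type*} [MeasurableSpace X]
    (f : X → X) (μ : Measure X) : EReal :=
  ⨆ (k : ℕ) (P : X → Fin k) (_ : Measurable P), entropyOfPartition f μ P

/-! ### Equilibrium states -/

/-- `μ` is an equilibrium state of `g`: it attains the supremum
`sup {h_ν(f) + ∫ g dν : ν invariant}`, that is, the pressure of `g`. -/
def IsEquilibriumState {X : Type*} [MetricSpace X] [MeasurableSpace X] (f : X → X) (g : X → ℝ)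
    (μ : InvariantMeasure f) : Prop :=
  metricEntropy f (μ.1 : Measure X) + ((∫ x, g x ∂(μ.1 : Measure X) : ℝ) : EReal) =
    ⨆ ν : InvariantMeasure f,
      (metricEntropy f (ν.1 : Measure X) + ((∫ x, g x ∂(ν.1 : Measure X) : ℝ) : EReal))

/-! ### Rotation sets and localized entropy -/

section Rotation

variable {X : Type*} [MetricSpace X] [MeasurableSpace X] {m : ℕ}

/-- The one-dimensional potential `v · Φ = v₁ Φ₁ + ⋯ + vₘ Φₘ`. -/
def dotPotential (v : EuclideanSpace ℝ (Fin m)) (Φ : C(X, EuclideanSpace ℝ (Fin m))) : X → ℝ :=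
  fun x => ∑ i, v i * Φ x i

/-- The rotation vector `(∫ Φ₁ dμ, …, ∫ Φₘ dμ)`. -/
noncomputable def rotationVector (Φ : C(X, EuclideanSpace ℝ (Fin m))) (μ : Measure X) :
    EuclideanSpace ℝ (Fin m) :=
  WithLp.toLp 2 fun i => ∫ x, Φ x i ∂μ

/-- The generalized rotation set of `Φ` with respect to `f`. -/
def rotationSet (f : X → X) (Φ : C(X, EuclideanSpace ℝ (Fin m))) :
    Set (EuclideanSpace ℝ (Fin m)) :=
  range fun μ : InvariantMeasure f => rotationVector Φ (μ.1 : Measure X)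

/-- The localized entropy `sup {h_μ(f) : μ invariant, rv(μ) = w}`. -/
noncomputable def localizedEntropy (f : X → X) (Φ : C(X, EuclideanSpace ℝ (Fin m)))
    (w : EuclideanSpace ℝ (Fin m)) : EReal :=
  ⨆ (μ : InvariantMeasure f) (_ : rotationVector Φ (μ.1 : Measure X) = w),
    metricEntropy f (μ.1 : Measure X)

end Rotation

/-- `(Φs n)` is an approximating sequence of `Φ` with errors `ε n`. -/
def IsApproximatingSequence {X : Type*} [MetricSpace X] [CompactSpace X] {m : ℕ}
    (Φ : C(X, EuclideanSpace ℝ (Fin m))) (Φs : ℕ → C(X, EuclideanSpace ℝ (Fin m)))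
    (ε : ℕ → ℝ) : Prop :=
  Tendsto ε atTop (𝓝 0) ∧ ∀ n, ‖Φs n - Φ‖ < ε n

/-! ### Oracle machines without queries, and with constant oracles -/

/-! The proof is convex duality made effective. Let `P v` be the supremum of `h_ν(f) + v · rv_Φ(ν)`
over invariant `ν`, the pressure of `v · Φ`. Entropy is concave in the measure and rotation vectors
are affine, so the hypograph of entropy over the rotation set is convex. A supporting hyperplane at
an interior point `w` shows that localized entropy at `w` is the attained minimum of `P v - v · w`
over `v` (`metricEntropy_concave`, `exists_supporting_vector`).

Three facts make this minimum computable. First, if a ball of radius `s` about `w` lies in the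
rotation set, a minimizer satisfies `s * ‖v‖ ≤ H w`, and `H w` is at most the maximal entropy `h 0
0`; the function `r` thus confines the search to a computable ball (`norm_supporting_vector_le`).
Secondly, the equilibrium states give the pressure of `v · Φs n` exactly, and it differs from `P v`
by at most `∑ |v i| * ε n`; hence `P` is computable at rational points (`exists_computable_approx`).
Thirdly, `P v - v · w` is Lipschitz in `v` with a constant independent of `w`, so a fine finite
rational grid suffices (`isComputableOn_of_isMin`).

On the machine side, the oracle serves only to bound `r w` below and to supply one rational
approximation of `w`. Everything else is an ordinary computable function of natural numbers. -/

theorem OracleCode.exists_eval_eq_of_partrec {g : ℕ →. ℕ} (hg : Nat.Partrec g) :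
    ∃ c : OracleCode, ∀ φ : ℕ → ℕ, c.eval φ = g := by
  induction hg with
  | zero => exact ⟨.zero, fun _ => rfl⟩
  | succ => exact ⟨.succ, fun _ => rfl⟩
  | left => exact ⟨.left, fun _ => rfl⟩
  | right => exact ⟨.right, fun _ => rfl⟩
  | pair _ _ hf hg =>
    obtain ⟨c, hc⟩ := hf
    obtain ⟨d, hd⟩ := hg
    exact ⟨.pair c d, fun φ => by simp only [OracleCode.eval, hc, hd]; rfl⟩
  | comp _ _ hf hg =>
    obtain ⟨c, hc⟩ := hf
    obtain ⟨d, hd⟩ := hg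
    exact ⟨.comp c d, fun φ => by simp only [OracleCode.eval, hc, hd]; rfl⟩
  | prec _ _ hf hg =>
    obtain ⟨c, hc⟩ := hf
    obtain ⟨d, hd⟩ := hg
    exact ⟨.prec c d, fun φ => by simp only [OracleCode.eval, hc, hd]; rfl⟩
  | rfind _ hf =>
    obtain ⟨c, hc⟩ := hf
    exact ⟨.rfind c, fun φ => by simp only [OracleCode.eval, hc]; rfl⟩

theorem OracleCode.exists_eval_eq_of_computable {g : ℕ → ℕ} (hg : Computable g) :
    ∃ c : OracleCode, ∀ (φ : ℕ → ℕ) (n : ℕ), c.eval φ n = Part.some (g n) := by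
  obtain ⟨c, hc⟩ := exists_eval_eq_of_partrec (Partrec.nat_iff.1 hg.partrec)
  exact ⟨c, fun φ n => by rw [hc]; rfl⟩

theorem Primrec.natPair {α : Type*} [Primcodable α] {f g : α → ℕ} (hf : Primrec f)
    (hg : Primrec g) : Primrec fun a => Nat.pair (f a) (g a) :=
  Primrec₂.natPair.comp hf hg

/-- Under a constant oracle a query merely returns the parameter `a`, so the run is an ordinary
partial recursive computation, uniformly in `a`. Constant oracles suffice for points of the dense
sequence. -/
theorem OracleCode.partrec₂_eval_const (c : OracleCode) :
    Partrec₂ fun a n : ℕ => c.eval (fun _ => a) n := by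
  have pr : Computable₂ Nat.pair := Primrec₂.natPair.to_comp
  induction c with
  | zero => exact (Computable.const 0).partrec
  | succ => exact (Computable.succ.comp Computable.snd).partrec
  | left => exact (Computable.fst.comp (Computable.unpair.comp Computable.snd)).partrec
  | right => exact (Computable.snd.comp (Computable.unpair.comp Computable.snd)).partrec
  | query => exact Computable.fst.partrec
  | pair c d hc hd =>
    have h : Partrec fun p : ℕ × ℕ => (c.eval (fun _ => p.1) p.2).bind fun x =>
        (d.eval (fun _ => p.1) p.2).map fun y => Nat.pair x y :=
      Partrec.bind hc (Partrec.map (f := fun q : (ℕ × ℕ) × ℕ => d.eval (fun _ => q.1.1) q.1.2)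
        (Partrec.comp hd Computable.fst) (pr.comp (Computable.snd.comp Computable.fst)
          Computable.snd).to₂).to₂
    refine h.of_eq fun p => ?_
    simp only [OracleCode.eval, Seq.seq]
    ext x; simp
  | comp c d hc hd =>
    exact Partrec.bind hd (Partrec.comp (f := fun p : ℕ × ℕ => c.eval (fun _ => p.1) p.2) hc
      (Computable.pair (Computable.fst.comp Computable.fst) Computable.snd)).to₂
  | prec c d hc hd =>
    have up : Computable fun p : ℕ × ℕ => Nat.unpair p.2 := Computable.unpair.comp Computable.snd
    have h : Partrec fun p : ℕ × ℕ => (Nat.rec (c.eval (fun _ => p.1) p.2.unpair.1)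
        (fun y IH => IH.bind fun i =>
          d.eval (fun _ => p.1) (Nat.pair p.2.unpair.1 (Nat.pair y i))) p.2.unpair.2 : Part ℕ) :=
      Partrec.nat_rec (h := fun (p : ℕ × ℕ) (q : ℕ × ℕ) =>
          d.eval (fun _ => p.1) (Nat.pair p.2.unpair.1 (Nat.pair q.1 q.2)))
        (Computable.snd.comp up)
        (Partrec.comp (f := fun p : ℕ × ℕ => c.eval (fun _ => p.1) p.2) hc
          (Computable.pair Computable.fst (Computable.fst.comp up)))
        (Partrec.comp (f := fun p : ℕ × ℕ => d.eval (fun _ => p.1) p.2) hd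
          (Computable.pair (Computable.fst.comp Computable.fst)
            (pr.comp (Computable.fst.comp (up.comp Computable.fst))
              (pr.comp (Computable.fst.comp Computable.snd)
                (Computable.snd.comp Computable.snd))))).to₂
    exact h.of_eq fun p => rfl
  | rfind c hc =>
    have h : Partrec fun p : ℕ × ℕ => Nat.rfind fun n =>
        (c.eval (fun _ => p.1) (Nat.pair p.2 n)).map fun m => decide (m = 0) := by
      have h1 : Partrec fun q : (ℕ × ℕ) × ℕ => c.eval (fun _ => q.1.1) (Nat.pair q.1.2 q.2) :=
        Partrec.comp (f := fun p : ℕ × ℕ => c.eval (fun _ => p.1) p.2) hc (Computable.pair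
          (Computable.fst.comp Computable.fst)
          (pr.comp (Computable.snd.comp Computable.fst) Computable.snd))
      have h2 : Computable₂ fun (_ : (ℕ × ℕ) × ℕ) (m : ℕ) => decide (m = 0) :=
        (Primrec.eq.decide.comp Primrec.snd (Primrec.const 0)).to_comp
      exact Partrec.rfind (h1.map h2)
    exact h.of_eq fun p => rfl

/-! ### Arithmetic on names of rational numbers -/

theorem Primrec.unpairFst : Primrec fun n : ℕ => n.unpair.1 := Primrec.fst.comp Primrec.unpair

theorem Primrec.unpairSnd : Primrec fun n : ℕ => n.unpair.2 := Primrec.snd.comp Primrec.unpair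

theorem Primrec₂.natPow : Primrec₂ fun a b : ℕ => a ^ b :=
  Primrec₂.unpaired'.1 Nat.Primrec.pow

/-- The name of a rational number with given data. -/
def ratCode (a b d : ℕ) : ℕ := Nat.pair (Nat.pair a b) d

theorem ratOfCode_ratCode (a b d : ℕ) :
    ratOfCode (ratCode a b d) = ((a : ℚ) - b) / ((d : ℚ) + 1) := by
  simp [ratCode, ratOfCode]

/-- The first entry of the numerator of a name. -/
def ratPos (c : ℕ) : ℕ := c.unpair.1.unpair.1
/-- The second entry of the numerator of a name. -/
def ratNeg (c : ℕ) : ℕ := c.unpair.1.unpair.2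
/-- The denominator of a name. -/
def ratDen (c : ℕ) : ℕ := c.unpair.2 + 1

theorem ratOfCode_eq (c : ℕ) : ratOfCode c = ((ratPos c : ℚ) - ratNeg c) / ratDen c := by
  simp [ratOfCode, ratPos, ratNeg, ratDen]

theorem ratDen_pos (c : ℕ) : 0 < ratDen c := Nat.succ_pos _

theorem primrec_ratPos : Primrec ratPos := Primrec.unpairFst.comp Primrec.unpairFst
theorem primrec_ratNeg : Primrec ratNeg := Primrec.unpairSnd.comp Primrec.unpairFst
theorem primrec_ratDen : Primrec ratDen := Primrec.succ.comp Primrec.unpairSnd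

/-- Addition on names of rational numbers. -/
def ratAdd (x y : ℕ) : ℕ :=
  ratCode (ratPos x * ratDen y + ratPos y * ratDen x) (ratNeg x * ratDen y + ratNeg y * ratDen x)
    (ratDen x * ratDen y - 1)

/-- Multiplication on names of rational numbers. -/
def ratMul (x y : ℕ) : ℕ :=
  ratCode (ratPos x * ratPos y + ratNeg x * ratNeg y) (ratPos x * ratNeg y + ratNeg x * ratPos y)
    (ratDen x * ratDen y - 1)

/-- Subtraction on names of rational numbers. -/
def ratSub (x y : ℕ) : ℕ :=
  ratCode (ratPos x * ratDen y + ratNeg y * ratDen x) (ratNeg x * ratDen y + ratPos y * ratDen x)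
    (ratDen x * ratDen y - 1)

/-- Names store the denominator minus one. The truncated subtraction loses nothing because the
product of denominators is positive. -/
theorem cast_ratDen_mul_sub_one (x y : ℕ) :
    ((ratDen x * ratDen y - 1 : ℕ) : ℚ) + 1 = ratDen x * ratDen y := by
  have : ratDen x * ratDen y - 1 + 1 = ratDen x * ratDen y :=
    Nat.succ_pred_eq_of_pos (Nat.mul_pos (ratDen_pos x) (ratDen_pos y))
  exact_mod_cast this

theorem ratOfCode_ratAdd (x y : ℕ) : ratOfCode (ratAdd x y) = ratOfCode x + ratOfCode y := by
  have hx : (ratDen x : ℚ) ≠ 0 := by exact_mod_cast (ratDen_pos x).ne'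
  have hy : (ratDen y : ℚ) ≠ 0 := by exact_mod_cast (ratDen_pos y).ne'
  rw [ratAdd, ratOfCode_ratCode, cast_ratDen_mul_sub_one, ratOfCode_eq x, ratOfCode_eq y]
  push_cast
  field_simp
  ring

theorem ratOfCode_ratSub (x y : ℕ) : ratOfCode (ratSub x y) = ratOfCode x - ratOfCode y := by
  have hx : (ratDen x : ℚ) ≠ 0 := by exact_mod_cast (ratDen_pos x).ne'
  have hy : (ratDen y : ℚ) ≠ 0 := by exact_mod_cast (ratDen_pos y).ne'
  rw [ratSub, ratOfCode_ratCode, cast_ratDen_mul_sub_one, ratOfCode_eq x, ratOfCode_eq y]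
  push_cast
  field_simp
  ring

theorem ratOfCode_ratMul (x y : ℕ) : ratOfCode (ratMul x y) = ratOfCode x * ratOfCode y := by
  have hx : (ratDen x : ℚ) ≠ 0 := by exact_mod_cast (ratDen_pos x).ne'
  have hy : (ratDen y : ℚ) ≠ 0 := by exact_mod_cast (ratDen_pos y).ne'
  rw [ratMul, ratOfCode_ratCode, cast_ratDen_mul_sub_one, ratOfCode_eq x, ratOfCode_eq y]
  push_cast
  field_simp
  ring

theorem primrec₂_ratAdd : Primrec₂ ratAdd := by
  have p1 := primrec_ratPos.comp (Primrec.fst (α := ℕ) (β := ℕ))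
  have p2 := primrec_ratPos.comp (Primrec.snd (α := ℕ) (β := ℕ))
  have n1 := primrec_ratNeg.comp (Primrec.fst (α := ℕ) (β := ℕ))
  have n2 := primrec_ratNeg.comp (Primrec.snd (α := ℕ) (β := ℕ))
  have d1 := primrec_ratDen.comp (Primrec.fst (α := ℕ) (β := ℕ))
  have d2 := primrec_ratDen.comp (Primrec.snd (α := ℕ) (β := ℕ))
  exact ((Primrec.nat_add.comp (Primrec.nat_mul.comp p1 d2) (Primrec.nat_mul.comp p2 d1)).natPair
    (Primrec.nat_add.comp (Primrec.nat_mul.comp n1 d2) (Primrec.nat_mul.comp n2 d1))).natPair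
    (Primrec.nat_sub.comp (Primrec.nat_mul.comp d1 d2) (Primrec.const 1))

theorem primrec₂_ratSub : Primrec₂ ratSub := by
  have p1 := primrec_ratPos.comp (Primrec.fst (α := ℕ) (β := ℕ))
  have p2 := primrec_ratPos.comp (Primrec.snd (α := ℕ) (β := ℕ))
  have n1 := primrec_ratNeg.comp (Primrec.fst (α := ℕ) (β := ℕ))
  have n2 := primrec_ratNeg.comp (Primrec.snd (α := ℕ) (β := ℕ))
  have d1 := primrec_ratDen.comp (Primrec.fst (α := ℕ) (β := ℕ))
  have d2 := primrec_ratDen.comp (Primrec.snd (α := ℕ) (β := ℕ))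
  exact ((Primrec.nat_add.comp (Primrec.nat_mul.comp p1 d2) (Primrec.nat_mul.comp n2 d1)).natPair
    (Primrec.nat_add.comp (Primrec.nat_mul.comp n1 d2) (Primrec.nat_mul.comp p2 d1))).natPair
    (Primrec.nat_sub.comp (Primrec.nat_mul.comp d1 d2) (Primrec.const 1))

theorem primrec₂_ratMul : Primrec₂ ratMul := by
  have p1 := primrec_ratPos.comp (Primrec.fst (α := ℕ) (β := ℕ))
  have p2 := primrec_ratPos.comp (Primrec.snd (α := ℕ) (β := ℕ))
  have n1 := primrec_ratNeg.comp (Primrec.fst (α := ℕ) (β := ℕ))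
  have n2 := primrec_ratNeg.comp (Primrec.snd (α := ℕ) (β := ℕ))
  have d1 := primrec_ratDen.comp (Primrec.fst (α := ℕ) (β := ℕ))
  have d2 := primrec_ratDen.comp (Primrec.snd (α := ℕ) (β := ℕ))
  exact ((Primrec.nat_add.comp (Primrec.nat_mul.comp p1 p2) (Primrec.nat_mul.comp n1 n2)).natPair
    (Primrec.nat_add.comp (Primrec.nat_mul.comp p1 n2) (Primrec.nat_mul.comp n1 p2))).natPair
    (Primrec.nat_sub.comp (Primrec.nat_mul.comp d1 d2) (Primrec.const 1))

/-- Clearing denominators and moving the subtracted parts across leaves only natural numbers, so the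
comparison is primitive recursive. -/
theorem ratOfCode_lt_iff (x y : ℕ) : ratOfCode x < ratOfCode y ↔
    ratPos x * ratDen y + ratNeg y * ratDen x < ratPos y * ratDen x + ratNeg x * ratDen y := by
  have hx : (0 : ℚ) < ratDen x := by exact_mod_cast ratDen_pos x
  have hy : (0 : ℚ) < ratDen y := by exact_mod_cast ratDen_pos y
  rw [ratOfCode_eq x, ratOfCode_eq y, div_lt_div_iff₀ hx hy, ← Nat.cast_lt (α := ℚ)]
  push_cast
  constructor <;> intro h <;> linarith

theorem primrecRel_ratLt : PrimrecRel fun x y => ratOfCode x < ratOfCode y := by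
  have p1 := primrec_ratPos.comp (Primrec.fst (α := ℕ) (β := ℕ))
  have p2 := primrec_ratPos.comp (Primrec.snd (α := ℕ) (β := ℕ))
  have n1 := primrec_ratNeg.comp (Primrec.fst (α := ℕ) (β := ℕ))
  have n2 := primrec_ratNeg.comp (Primrec.snd (α := ℕ) (β := ℕ))
  have d1 := primrec_ratDen.comp (Primrec.fst (α := ℕ) (β := ℕ))
  have d2 := primrec_ratDen.comp (Primrec.snd (α := ℕ) (β := ℕ))
  exact (Primrec.nat_lt.comp
    (Primrec.nat_add.comp (Primrec.nat_mul.comp p1 d2) (Primrec.nat_mul.comp n2 d1))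
    (Primrec.nat_add.comp (Primrec.nat_mul.comp p2 d1) (Primrec.nat_mul.comp n1 d2))).of_eq
    fun p => (ratOfCode_lt_iff p.1 p.2).symm

/-- A name of the rational number `2 / 2ˡ`. -/
def ratTwoDivPow (l : ℕ) : ℕ := ratCode 2 0 (2 ^ l - 1)

theorem ratOfCode_ratTwoDivPow (l : ℕ) : ratOfCode (ratTwoDivPow l) = 2 * (1 / 2) ^ l := by
  have : ((2 ^ l - 1 : ℕ) : ℚ) + 1 = 2 ^ l := by
    exact_mod_cast Nat.succ_pred_eq_of_pos (pow_pos (by norm_num : 0 < 2) l)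
  rw [ratTwoDivPow, ratOfCode_ratCode, this]
  simp [div_eq_mul_inv]

theorem primrec_ratTwoDivPow : Primrec ratTwoDivPow :=
  (Primrec.const _).natPair
    (Primrec.nat_sub.comp (Primrec₂.natPow.comp (Primrec.const 2) Primrec.id) (Primrec.const 1))

/-- Pairing dominates its components and denominators are at least one. The bound is crude, but it
can be read off the name alone, which is all that choosing a precision requires. -/
theorem abs_ratOfCode_le (c : ℕ) : |ratOfCode c| ≤ c := by
  have h1 : ratPos c ≤ c := (Nat.unpair_left_le _).trans (Nat.unpair_left_le _)
  have h2 : ratNeg c ≤ c := (Nat.unpair_right_le _).trans (Nat.unpair_left_le _)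
  have hd : (1 : ℚ) ≤ ratDen c := by exact_mod_cast ratDen_pos c
  have h1' : (ratPos c : ℚ) ≤ c := by exact_mod_cast h1
  have h2' : (ratNeg c : ℚ) ≤ c := by exact_mod_cast h2
  rw [ratOfCode_eq, abs_div, abs_of_pos (by linarith : (0 : ℚ) < ratDen c)]
  refine (div_le_self (abs_nonneg _) hd).trans (abs_le.2 ⟨?_, ?_⟩)
  · have : (0 : ℚ) ≤ ratPos c := by positivity
    linarith
  · have : (0 : ℚ) ≤ ratNeg c := by positivity
    linarith

/-! ### Tuples -/

theorem tupleEntry_succ (c i : ℕ) : tupleEntry c (i + 1) = tupleEntry c.unpair.2 i := rfl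

theorem tupleEntry_le (c i : ℕ) : tupleEntry c i ≤ c := by
  induction i generalizing c with
  | zero => exact Nat.unpair_left_le c
  | succ i ih => exact (ih _).trans (Nat.unpair_right_le c)

theorem primrec_tupleEntry (i : ℕ) : Primrec fun c => tupleEntry c i := by
  induction i with
  | zero => exact Primrec.unpairFst
  | succ i ih => exact ih.comp Primrec.unpairSnd

/-- The tuple all of whose `m` entries are `e`. -/
def constTuple : ℕ → ℕ → ℕ
  | 0, _ => 0
  | m + 1, e => Nat.pair e (constTuple m e)

theorem primrec_constTuple (m : ℕ) : Primrec (constTuple m) := by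
  induction m with
  | zero => exact Primrec.const 0
  | succ m ih => exact Primrec.id.natPair ih

theorem Nat.pair_le_pair {a b c d : ℕ} (h : a ≤ c) (h' : b ≤ d) : Nat.pair a b ≤ Nat.pair c d := by
  refine le_trans (b := Nat.pair c b) ?_ ?_
  · rcases h.eq_or_lt with rfl | h
    · exact le_rfl
    · exact (Nat.pair_lt_pair_left b h).le
  · rcases h'.eq_or_lt with rfl | h'
    · exact le_rfl
    · exact (Nat.pair_lt_pair_right c h').le

/-- Monotonicity of pairing turns a search over a finite grid of tuples into a search over all names
up to one computable bound. -/
theorem exists_tupleEntry_le_constTuple (m e : ℕ) (a : ℕ → ℕ) (ha : ∀ i, a i ≤ e) :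
    ∃ c ≤ constTuple m e, ∀ i < m, tupleEntry c i = a i := by
  induction m generalizing a with
  | zero => exact ⟨0, le_rfl, fun i hi => absurd hi (Nat.not_lt_zero i)⟩
  | succ m ih =>
    obtain ⟨c, hc, hci⟩ := ih (fun i => a (i + 1)) fun i => ha _
    refine ⟨Nat.pair (a 0) c, Nat.pair_le_pair (ha 0) hc, fun i hi => ?_⟩
    cases i with
    | zero => simp [tupleEntry]
    | succ i => simpa [tupleEntry_succ] using hci i (by omega)

/-- The name of the dot product of two tuples of rational numbers. -/
def ratDot : ℕ → ℕ → ℕ → ℕ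
  | 0, _, _ => 0
  | m + 1, x, y => ratAdd (ratMul (tupleEntry x m) (tupleEntry y m)) (ratDot m x y)

theorem primrec₂_ratDot (m : ℕ) : Primrec₂ (ratDot m) := by
  induction m with
  | zero => exact (Primrec.const 0).to₂
  | succ m ih =>
    exact primrec₂_ratAdd.comp (primrec₂_ratMul.comp ((primrec_tupleEntry m).comp Primrec.fst)
      ((primrec_tupleEntry m).comp Primrec.snd)) ih

theorem ratOfCode_ratDot (m x y : ℕ) : (ratOfCode (ratDot m x y) : ℝ) =
    ∑ i : Fin m, ratVecOfCode m x i * ratVecOfCode m y i := by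
  have h : ratOfCode (ratDot m x y) =
      ∑ i ∈ Finset.range m, ratOfCode (tupleEntry x i) * ratOfCode (tupleEntry y i) := by
    induction m with
    | zero => simp [ratDot, ratOfCode]
    | succ m ih => rw [ratDot, ratOfCode_ratAdd, ratOfCode_ratMul, ih, Finset.sum_range_succ,
        add_comm]
  rw [h, Finset.sum_range]
  push_cast
  rfl

theorem abs_ratVecOfCode_le (m c : ℕ) (i : Fin m) : |ratVecOfCode m c i| ≤ c := by
  have h : |((ratOfCode (tupleEntry c i) : ℚ) : ℝ)| ≤ (tupleEntry c i : ℝ) := by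
    exact_mod_cast abs_ratOfCode_le (tupleEntry c i)
  exact h.trans (by exact_mod_cast tupleEntry_le c i)

/-! ### Minima of finitely many rational numbers -/

/-- The name of the smallest among the rational numbers named by `s 0, …, s n`. -/
def ratMin (s : ℕ → ℕ) (n : ℕ) : ℕ :=
  Nat.rec (s 0) (fun y IH => if ratOfCode (s (y + 1)) < ratOfCode IH then s (y + 1) else IH) n

theorem ratOfCode_ratMin_le (s : ℕ → ℕ) {c n : ℕ} (h : c ≤ n) :
    ratOfCode (ratMin s n) ≤ ratOfCode (s c) := by
  have hs : ∀ n, ratMin s (n + 1) = if ratOfCode (s (n + 1)) < ratOfCode (ratMin s n)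
    then s (n + 1) else ratMin s n := fun _ => rfl
  induction n with
  | zero => obtain rfl : c = 0 := by omega
            exact le_rfl
  | succ n ih =>
    rw [hs]
    rcases Nat.le_succ_iff.1 h with h | rfl <;> split_ifs with h'
    · exact h'.le.trans (ih h)
    · exact ih h
    · exact le_rfl
    · exact not_lt.1 h'

theorem exists_ratMin_eq (s : ℕ → ℕ) (n : ℕ) : ∃ c ≤ n, ratMin s n = s c := by
  have hs : ∀ n, ratMin s (n + 1) = if ratOfCode (s (n + 1)) < ratOfCode (ratMin s n)
    then s (n + 1) else ratMin s n := fun _ => rfl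
  induction n with
  | zero => exact ⟨0, le_rfl, rfl⟩
  | succ n ih =>
    rw [hs]
    split_ifs
    · exact ⟨_, le_rfl, rfl⟩
    · obtain ⟨c, hc, h⟩ := ih
      exact ⟨c, hc.trans n.le_succ, h⟩

theorem computable_ratMin {α : Type*} [Primcodable α] {s : α → ℕ → ℕ} {n : α → ℕ}
    (hs : Computable₂ s) (hn : Computable n) : Computable fun a => ratMin (s a) (n a) := by
  have h1 : Computable fun p : α × ℕ × ℕ => s p.1 (p.2.1 + 1) :=
    hs.comp Computable.fst (Computable.succ.comp (Computable.fst.comp Computable.snd))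
  have h2 : Computable fun p : α × ℕ × ℕ => p.2.2 := Computable.snd.comp Computable.snd
  have h3 : Computable fun p : α × ℕ × ℕ =>
      decide (ratOfCode (s p.1 (p.2.1 + 1)) < ratOfCode p.2.2) :=
    primrecRel_ratLt.decide.to_comp.comp h1 h2
  refine (Computable.nat_rec hn (hs.comp Computable.id (Computable.const 0))
    (Computable.cond h3 h1 h2).to₂).of_eq fun a => ?_
  simp only [ratMin, Bool.cond_decide, id]

/-! ### Concavity of entropy -/

/-- Each `p i` is at most the whole sum, so replacing the logarithm of the sum by `log (p i)` can
only increase the corresponding term. -/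
theorem Real.negMulLog_sum_le {ι : Type*} (s : Finset ι) (p : ι → ℝ) (hp : ∀ i ∈ s, 0 ≤ p i) :
    Real.negMulLog (∑ i ∈ s, p i) ≤ ∑ i ∈ s, Real.negMulLog (p i) := by
  rw [Real.negMulLog, ← Finset.sum_neg_distrib, Finset.sum_mul]
  refine Finset.sum_le_sum fun i hi => ?_
  rcases (hp i hi).eq_or_lt with h | h
  · simp [← h]
  · have h1 : Real.log (p i) ≤ Real.log (∑ i ∈ s, p i) :=
      Real.log_le_log h (Finset.single_le_sum hp hi)
    rw [Real.negMulLog]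
    nlinarith

section PartitionEntropy

variable {X α β : Type*} [MeasurableSpace X] [Fintype α] [Fintype β]

theorem partitionEntropy_nonneg (μ : Measure X) [IsProbabilityMeasure μ] (P : X → α) :
    0 ≤ partitionEntropy μ P :=
  Finset.sum_nonneg fun _ _ => Real.negMulLog_nonneg measureReal_nonneg measureReal_le_one

/-- Fibres of the coarser labelling are disjoint unions of fibres of `P`, so subadditivity of
`negMulLog` applies to each. -/
theorem partitionEntropy_comp_le (μ : Measure X) [IsProbabilityMeasure μ] [MeasurableSpace α]
    [MeasurableSingletonClass α] {P : X → α} (hP : Measurable P) (g : α → β) :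
    partitionEntropy μ (g ∘ P) ≤ partitionEntropy μ P := by
  classical
  unfold partitionEntropy
  rw [← Finset.sum_fiberwise (Finset.univ : Finset α) g]
  refine Finset.sum_le_sum fun b _ => ?_
  have h : μ.real ((g ∘ P) ⁻¹' {b}) = ∑ a ∈ Finset.univ with g a = b, μ.real (P ⁻¹' {a}) := by
    rw [← measureReal_biUnion_finset]
    · congr 1
      ext x
      simp
    · intro a _ a' _ haa'
      exact Disjoint.preimage P (by simpa using haa')
    · exact fun a _ => hP (measurableSet_singleton a)
  rw [h]
  exact Real.negMulLog_sum_le _ _ fun _ _ => measureReal_nonneg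

theorem partitionEntropy_concave {μ ν ρ : Measure X} {a b : ℝ} (ha : 0 ≤ a) (hb : 0 ≤ b)
    (hab : a + b = 1) (hρ : ∀ s, ρ.real s = a * μ.real s + b * ν.real s) (P : X → α) :
    a * partitionEntropy μ P + b * partitionEntropy ν P ≤ partitionEntropy ρ P := by
  unfold partitionEntropy
  rw [Finset.mul_sum, Finset.mul_sum, ← Finset.sum_add_distrib]
  refine Finset.sum_le_sum fun i _ => ?_
  rw [hρ]
  exact Real.concaveOn_negMulLog.2 measureReal_nonneg measureReal_nonneg ha hb hab

end PartitionEntropy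

section Entropy

variable {X : Type*} [MeasurableSpace X]

theorem measurable_itinerary {k : ℕ} {f : X → X} (hf : Measurable f) {P : X → Fin k}
    (hP : Measurable P) (n : ℕ) : Measurable (itinerary f P n) :=
  measurable_pi_lambda _ fun i => hP.comp (hf.iterate i)

theorem partitionEntropy_itinerary_comp_le {k l : ℕ} {f : X → X} (hf : Measurable f)
    (μ : Measure X) [IsProbabilityMeasure μ] {P : X → Fin k} (hP : Measurable P)
    (g : Fin k → Fin l) (n : ℕ) :
    partitionEntropy μ (itinerary f (g ∘ P) n) ≤ partitionEntropy μ (itinerary f P n) :=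
  partitionEntropy_comp_le μ (measurable_itinerary hf hP n) fun u i => g (u i)

theorem metricEntropy_nonneg (f : X → X) (μ : Measure X) [IsProbabilityMeasure μ] :
    0 ≤ metricEntropy f μ := by
  refine le_iSup_of_le 1 (le_iSup_of_le (fun _ => 0) (le_iSup_of_le measurable_const ?_))
  refine le_liminf_of_le (by isBoundedDefault) (Eventually.of_forall fun n => ?_)
  have := partitionEntropy_nonneg μ (itinerary f (fun _ : X => (0 : Fin 1)) n)
  exact_mod_cast div_nonneg this n.cast_nonneg

theorem exists_eventually_lt_of_lt_metricEntropy {f : X → X} {μ : Measure X} {x : ℝ}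
    (hx : (x : EReal) < metricEntropy f μ) : ∃ (k : ℕ) (P : X → Fin k), Measurable P ∧
      ∀ᶠ n : ℕ in atTop, x < partitionEntropy μ (itinerary f P n) / n := by
  simp only [metricEntropy, lt_iSup_iff] at hx
  obtain ⟨k, P, hP, h⟩ := hx
  refine ⟨k, P, hP, ?_⟩
  filter_upwards [eventually_lt_of_lt_liminf h] with n hn
  exact_mod_cast hn

/-- Strict lower bounds for the two entropies are witnessed by two partitions. Both bounds survive
passage to the common refinement, where concavity holds for each `n`. Since they hold eventually in
`n`, they bound the `liminf` for `ρ`; no limit has to exist. -/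
theorem metricEntropy_concave {f : X → X} (hf : Measurable f) {μ ν ρ : Measure X}
    [IsProbabilityMeasure μ] [IsProbabilityMeasure ν] {a b : ℝ} (ha : 0 ≤ a)
    (hb : 0 ≤ b) (hab : a + b = 1) (hρ : ∀ s, ρ.real s = a * μ.real s + b * ν.real s) {x y : ℝ}
    (hx : (x : EReal) < metricEntropy f μ) (hy : (y : EReal) < metricEntropy f ν) :
    ((a * x + b * y : ℝ) : EReal) ≤ metricEntropy f ρ := by
  obtain ⟨k, P, hP, hPx⟩ := exists_eventually_lt_of_lt_metricEntropy hx
  obtain ⟨l, Q, hQ, hQy⟩ := exists_eventually_lt_of_lt_metricEntropy hy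
  set J : X → Fin (k * l) := fun z => finProdFinEquiv (P z, Q z)
  have hJm : Measurable J := (measurable_of_finite _).comp (hP.prodMk hQ)
  have hJP : (fun i => (finProdFinEquiv.symm i).1) ∘ J = P :=
    funext fun z => congrArg Prod.fst (finProdFinEquiv.symm_apply_apply (P z, Q z))
  have hJQ : (fun i => (finProdFinEquiv.symm i).2) ∘ J = Q :=
    funext fun z => congrArg Prod.snd (finProdFinEquiv.symm_apply_apply (P z, Q z))
  refine le_iSup_of_le (k * l) (le_iSup_of_le J (le_iSup_of_le hJm ?_))
  refine le_liminf_of_le (by isBoundedDefault) ?_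
  filter_upwards [hPx, hQy] with n hn hn'
  have h1 := partitionEntropy_itinerary_comp_le hf μ hJm (fun i => (finProdFinEquiv.symm i).1) n
  have h2 := partitionEntropy_itinerary_comp_le hf ν hJm (fun i => (finProdFinEquiv.symm i).2) n
  rw [hJP] at h1
  rw [hJQ] at h2
  have h3 := partitionEntropy_concave ha hb hab hρ (itinerary f J n)
  have hn0 : (0 : ℝ) ≤ n := n.cast_nonneg
  have h1' := hn.le.trans (div_le_div_of_nonneg_right h1 hn0)
  have h2' := hn'.le.trans (div_le_div_of_nonneg_right h2 hn0)
  have h3' := div_le_div_of_nonneg_right h3 hn0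
  rw [add_div, mul_div_assoc, mul_div_assoc] at h3'
  have := mul_le_mul_of_nonneg_left h1' ha
  have := mul_le_mul_of_nonneg_left h2' hb
  exact EReal.coe_le_coe_iff.2 (by linarith)

end Entropy

section InvariantMeasure

variable {X : Type*} [MetricSpace X] [MeasurableSpace X]

theorem InvariantMeasure.exists_convexCombination {f : X → X} (μ ν : InvariantMeasure f)
    {a b : ℝ} (ha : 0 ≤ a) (hb : 0 ≤ b) (hab : a + b = 1) :
    ∃ ρ : InvariantMeasure f, (ρ.1 : Measure X) =
      ENNReal.ofReal a • (μ.1 : Measure X) + ENNReal.ofReal b • (ν.1 : Measure X) := by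
  set ρ : Measure X :=
    ENNReal.ofReal a • (μ.1 : Measure X) + ENNReal.ofReal b • (ν.1 : Measure X) with hρ
  have hp : IsProbabilityMeasure ρ := ⟨by
    simp [hρ, ← ENNReal.ofReal_add ha hb, hab]⟩
  have hm : MeasurePreserving f ρ ρ := by
    refine ⟨μ.2.measurable, ?_⟩
    rw [hρ, Measure.map_add _ _ μ.2.measurable, Measure.map_smul, Measure.map_smul, μ.2.map_eq,
      ν.2.map_eq]
  exact ⟨⟨⟨ρ, hp⟩, hm⟩, rfl⟩

theorem InvariantMeasure.exists_metricEntropy_concave {f : X → X}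
    (μ ν : InvariantMeasure f) {a b : ℝ} (ha : 0 ≤ a) (hb : 0 ≤ b) (hab : a + b = 1)
    {B : ℝ} (hB : ∀ μ : InvariantMeasure f, metricEntropy f (μ.1 : Measure X) ≤ (B : EReal)) :
    ∃ ρ : InvariantMeasure f, (ρ.1 : Measure X) =
        ENNReal.ofReal a • (μ.1 : Measure X) + ENNReal.ofReal b • (ν.1 : Measure X) ∧
      a * (metricEntropy f (μ.1 : Measure X)).toReal +
        b * (metricEntropy f (ν.1 : Measure X)).toReal ≤
          (metricEntropy f (ρ.1 : Measure X)).toReal := by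
  obtain ⟨ρ, hρ⟩ := exists_convexCombination μ ν ha hb hab
  have hc (μ : InvariantMeasure f) : ((metricEntropy f (μ.1 : Measure X)).toReal : EReal) =
      metricEntropy f (μ.1 : Measure X) :=
    EReal.coe_toReal (ne_top_of_le_ne_top (EReal.coe_ne_top B) (hB μ))
      (ne_bot_of_le_ne_bot (by simp) (metricEntropy_nonneg f _))
  refine ⟨ρ, hρ, le_of_forall_pos_le_add fun δ hδ => ?_⟩
  have hρs (s : Set X) : (ρ.1 : Measure X).real s =
      a * (μ.1 : Measure X).real s + b * (ν.1 : Measure X).real s := by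
    have hfin (c : ℝ) (μ : InvariantMeasure f) :
        (ENNReal.ofReal c • (μ.1 : Measure X)) s ≠ ⊤ :=
      ENNReal.mul_ne_top ENNReal.ofReal_ne_top (measure_ne_top _ _)
    rw [hρ, measureReal_add_apply (hfin a μ) (hfin b ν), measureReal_ennreal_smul_apply,
      measureReal_ennreal_smul_apply, ENNReal.toReal_ofReal ha, ENNReal.toReal_ofReal hb]
  -- Lowering both entropies by `δ` makes the bounds strict. As `a + b = 1`, the total loss is
  -- exactly `δ`, which is arbitrary.
  have h := metricEntropy_concave (x := (metricEntropy f (μ.1 : Measure X)).toReal - δ)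
    (y := (metricEntropy f (ν.1 : Measure X)).toReal - δ) μ.2.measurable ha hb hab hρs
    (by rw [← hc μ]; exact EReal.coe_lt_coe_iff.2 (by simpa using hδ))
    (by rw [← hc ν]; exact EReal.coe_lt_coe_iff.2 (by simpa using hδ))
  rw [← hc ρ, EReal.coe_le_coe_iff] at h
  linear_combination h + δ * hab

end InvariantMeasure

/-! ### Duality -/

/-- A supporting hyperplane, at an interior point of the domain, of the concave hull of a family of
points lying over that domain. -/
theorem exists_supporting_vector {E : Type*} [NormedAddCommGroup E] [InnerProductSpace ℝ E]
    [CompleteSpace E] {ι : Type*} (x : ι → E) (η : ι → ℝ) (hη : ∀ i, 0 ≤ η i)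
    (hc : ∀ i j (a b : ℝ), 0 ≤ a → 0 ≤ b → a + b = 1 →
      ∃ k, x k = a • x i + b • x j ∧ a * η i + b * η j ≤ η k)
    {w : E} (hw : w ∈ interior (range x)) {H : ℝ} (hH : IsLUB {t | ∃ i, x i = w ∧ t = η i} H) :
    ∃ v : E, ∀ i, η i + inner ℝ v (x i - w) ≤ H := by
  set A : Set (E × ℝ) := {p | ∃ i, x i = p.1 ∧ p.2 ≤ η i} with hA
  have hAc : Convex ℝ A := by
    rintro ⟨y, s⟩ ⟨i, hi, hi'⟩ ⟨z, t⟩ ⟨j, hj, hj'⟩ a b ha hb hab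
    obtain ⟨k, hk, hk'⟩ := hc i j a b ha hb hab
    refine ⟨k, by rw [hk, hi, hj]; rfl, le_trans ?_ hk'⟩
    exact add_le_add (mul_le_mul_of_nonneg_left hi' ha) (mul_le_mul_of_nonneg_left hj' hb)
  -- Since `η` is nonnegative, the hypograph contains everything below height zero over the domain,
  -- so it has interior points beneath `w`.
  have hsub : interior (range x) ×ˢ Iio (0 : ℝ) ⊆ interior A := by
    refine interior_maximal ?_ (isOpen_interior.prod isOpen_Iio)
    rintro ⟨y, s⟩ ⟨hy, hs⟩
    obtain ⟨i, hi⟩ := interior_subset hy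
    exact ⟨i, hi, (le_of_lt hs).trans (hη i)⟩
  have hw1 : (w, (-1 : ℝ)) ∈ interior A := hsub ⟨hw, by simp⟩
  have hnot : (w, H) ∉ interior A := by
    intro h
    have h1 : Tendsto (fun t : ℝ => (w, H + t)) (𝓝[>] 0) (𝓝 (w, H)) := by
      have : ContinuousAt (fun t : ℝ => (w, H + t)) 0 := by fun_prop
      simpa using this.tendsto.mono_left nhdsWithin_le_nhds
    obtain ⟨t, ht, ht0⟩ := ((h1.eventually (isOpen_interior.mem_nhds h)).and
      self_mem_nhdsWithin).exists
    obtain ⟨i, hi, hi'⟩ := interior_subset ht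
    have := hH.1 ⟨i, hi, rfl⟩
    simp only at hi' ht0
    have ht0' : (0 : ℝ) < t := ht0
    linarith
  obtain ⟨ℓ, hℓ⟩ := geometric_hahn_banach_open_point hAc.interior isOpen_interior hnot
  have hℓA (p : E × ℝ) (hp : p ∈ A) : ℓ p ≤ ℓ (w, H) := by
    -- Separation is only available on the interior. A convex set with nonempty interior lies in the
    -- closure of that interior, so the weak inequality extends to all of `A`.
    have h1 : p ∈ closure (interior A) := by
      rw [hAc.closure_interior_eq_closure_of_nonempty_interior ⟨_, hw1⟩]
      exact subset_closure hp
    exact closure_minimal (t := {p | ℓ p ≤ ℓ (w, H)}) (fun q hq => (hℓ q hq).le)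
      (isClosed_le ℓ.continuous continuous_const) h1
  set g : StrongDual ℝ E := ℓ.comp (ContinuousLinearMap.inl ℝ E ℝ) with hg
  set s : ℝ := ℓ (0, 1) with hs
  have hdec (y : E) (t : ℝ) : ℓ (y, t) = g y + t * s := by
    have : (y, t) = (y, (0 : ℝ)) + t • ((0 : E), (1 : ℝ)) := by simp
    rw [this, map_add, map_smul]
    rfl
  have h0H : 0 ≤ H := by
    obtain ⟨i, hi⟩ := interior_subset hw
    exact (hη i).trans (hH.1 ⟨i, hi, rfl⟩)
  -- The hyperplane is not vertical: `(w, -1)` is interior and lies directly below `(w, H)`.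
  -- Dividing by `s` then turns the functional into a slope.
  have hs0 : 0 < s := by
    have := hℓ _ hw1
    rw [hdec, hdec] at this
    have h1 : 0 < (H + 1) * s := by linarith
    exact pos_of_mul_pos_right h1 (by linarith)
  refine ⟨s⁻¹ • (InnerProductSpace.toDual ℝ E).symm g, fun i => ?_⟩
  have h1 := hℓA (x i, η i) ⟨i, rfl, le_rfl⟩
  rw [hdec, hdec] at h1
  rw [inner_smul_left, InnerProductSpace.toDual_symm_apply, map_sub]
  have h2 : s⁻¹ * (g (x i) - g w) ≤ s⁻¹ * ((H - η i) * s) :=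
    mul_le_mul_of_nonneg_left (by linarith) (inv_nonneg.2 hs0.le)
  have h3 : s⁻¹ * ((H - η i) * s) = H - η i := by field_simp
  simp only [conj_trivial]
  linarith

/-- Test the supporting inequality at the point of the ball furthest in the direction of `v`: there
the inner product is `s * ‖v‖`, and `η` is nonnegative. -/
theorem norm_supporting_vector_le {E : Type*} [NormedAddCommGroup E] [InnerProductSpace ℝ E]
    {ι : Type*} {x : ι → E} {η : ι → ℝ} (hη : ∀ i, 0 ≤ η i)
    {w v : E} {H s : ℝ} (hs : 0 < s) (hball : Metric.closedBall w s ⊆ range x)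
    (hv : ∀ i, η i + inner ℝ v (x i - w) ≤ H) : s * ‖v‖ ≤ H := by
  rcases eq_or_ne v 0 with rfl | hv0
  · obtain ⟨i, hi⟩ := hball (Metric.mem_closedBall_self hs.le)
    have := hv i
    simp only [inner_zero_left, add_zero] at this
    simpa using (hη i).trans this
  · have hn : ‖v‖ ≠ 0 := norm_ne_zero_iff.2 hv0
    have hmem : w + (s / ‖v‖) • v ∈ Metric.closedBall w s := by
      rw [mem_closedBall_iff_norm, add_sub_cancel_left, norm_smul, norm_div, norm_norm,
        div_mul_cancel₀ _ hn, Real.norm_eq_abs, abs_of_pos hs]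
    obtain ⟨i, hi⟩ := hball hmem
    have := hv i
    rw [hi, add_sub_cancel_left, inner_smul_right, real_inner_self_eq_norm_sq] at this
    have h2 : s / ‖v‖ * ‖v‖ ^ 2 = s * ‖v‖ := by field_simp
    linarith [hη i]

/-! ### Computable approximations on the dense sequence -/

theorem Computable.exists_find {α : Type*} [Primcodable α] {p : α → ℕ → Bool}
    (hp : Computable₂ p) (h : ∀ a, ∃ n, p a n = true) :
    ∃ g : α → ℕ, Computable g ∧ ∀ a, p a (g a) = true := by
  have h1 (a : α) : ∃ n, n ∈ Nat.rfind (fun n => (p a n : Part Bool)) := by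
    obtain ⟨n, hn⟩ := h a
    obtain ⟨k, hk, -⟩ := Nat.rfind_min' (p := p a) hn
    exact ⟨k, hk⟩
  choose g hg using h1
  refine ⟨g, (Partrec.rfind hp.partrec₂).of_eq_tot hg, fun a => ?_⟩
  exact (Part.mem_some_iff.1 (Nat.rfind_spec (hg a))).symm

theorem OracleCode.eval_comp_of_eq {φ : ℕ → ℕ} {c d : OracleCode} {n x : ℕ}
    (hd : d.eval φ n = Part.some x) : (OracleCode.comp c d).eval φ n = c.eval φ x := by
  change (d.eval φ n).bind (c.eval φ) = _
  rw [hd]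
  exact Part.bind_some x _

theorem OracleCode.eval_pair_of_eq {φ : ℕ → ℕ} {c d : OracleCode} {n x y : ℕ}
    (hc : c.eval φ n = Part.some x) (hd : d.eval φ n = Part.some y) :
    (OracleCode.pair c d).eval φ n = Part.some (Nat.pair x y) := by
  change Nat.pair <$> c.eval φ n <*> d.eval φ n = _
  rw [hc, hd]
  simp [Seq.seq]

/-- The constant function `c` is an oracle for the `c`-th dense point, so on dense points the oracle
machine becomes an ordinary algorithm. -/
theorem IsComputableFunSeq.exists_computable {X Y : Type*} [MetricSpace X]
    [ComputableMetricSpace X] [MetricSpace Y] [ComputableMetricSpace Y] {F : ℕ → X → Y}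
    (hF : IsComputableFunSeq F) : ∃ g : ℕ × ℕ × ℕ → ℕ, Computable g ∧ ∀ c n k : ℕ,
      dist (ComputableMetricSpace.seq (g (c, n, k))) (F n (ComputableMetricSpace.seq c)) <
        (1 / 2 : ℝ) ^ k := by
  obtain ⟨e, he⟩ := hF
  have h1 (c n k : ℕ) := he (ComputableMetricSpace.seq c) (fun _ => c)
    (fun n => by rw [dist_self]; positivity) n k
  choose g hg hgd using h1
  refine ⟨fun p => g p.1 p.2.1 p.2.2, ?_, hgd⟩
  have h2 : Partrec fun p : ℕ × ℕ × ℕ => e.eval (fun _ => p.1) (Nat.pair p.2.1 p.2.2) :=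
    Partrec.comp (f := fun p : ℕ × ℕ => e.eval (fun _ => p.1) p.2) e.partrec₂_eval_const
      (Computable.pair Computable.fst (Primrec₂.natPair.to_comp.comp
        (Computable.fst.comp Computable.snd) (Computable.snd.comp Computable.snd)))
  exact h2.of_eq_tot fun p => hg _ _ _

/-- Used to absorb a factor `n` in an error bound by asking for `n` more binary digits. -/
theorem two_pow_mul_le_one (n : ℕ) : (1 / 2 : ℝ) ^ n * n ≤ 1 := by
  have h : (n : ℝ) ≤ 2 ^ n := by exact_mod_cast Nat.lt_two_pow_self.le
  rw [div_pow, one_pow, div_mul_eq_mul_div, one_mul]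
  exact div_le_one_of_le₀ h (by positivity)

theorem abs_dist_coord_le {m : ℕ} (x y : EuclideanSpace ℝ (Fin m)) (i : Fin m) :
    |x i - y i| ≤ dist x y := by
  rw [dist_eq_norm, ← PiLp.sub_apply, ← Real.norm_eq_abs]
  exact PiLp.norm_apply_le (x - y) i

theorem abs_ratDot_sub_le {m c N y : ℕ} (hc : c ≤ N) {x : EuclideanSpace ℝ (Fin m)} {δ : ℝ}
    (h : dist x (ratVecOfCode m y) ≤ δ) :
    |(ratOfCode (ratDot m c y) : ℝ) - ∑ i, ratVecOfCode m c i * x i| ≤ (m * N : ℕ) * δ := by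
  rw [ratOfCode_ratDot, ← Finset.sum_sub_distrib]
  refine (Finset.abs_sum_le_sum_abs _ _).trans ?_
  have h1 (i : Fin m) (_ : i ∈ Finset.univ) :
      |ratVecOfCode m c i * ratVecOfCode m y i - ratVecOfCode m c i * x i| ≤ N * δ := by
    rw [← mul_sub, abs_mul, abs_sub_comm]
    exact mul_le_mul ((abs_ratVecOfCode_le m c i).trans (Nat.cast_le.2 hc))
      ((abs_dist_coord_le _ _ i).trans h) (abs_nonneg _) (by positivity)
  refine (Finset.sum_le_sum h1).trans (le_of_eq ?_)
  simp [mul_assoc]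

/-- A function on `ℝᵐ` that is approximated by a computable sequence `h n v + v · R n v`, with an
error controlled by a computable sequence tending to zero, is computable on the dense sequence. -/
theorem exists_computable_approx {m : ℕ} {P : EuclideanSpace ℝ (Fin m) → ℝ}
    {h : ℕ → EuclideanSpace ℝ (Fin m) → ℝ}
    {R : ℕ → EuclideanSpace ℝ (Fin m) → EuclideanSpace ℝ (Fin m)} {ε : ℕ → ℝ}
    (hh : IsComputableFunSeq h) (hR : IsComputableFunSeq R) (hε : IsComputablePointSeq ε)
    (hε0 : Tendsto ε atTop (𝓝 0)) (hP : ∀ n v, |h n v + ∑ i, v i * R n v i - P v| ≤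
      ∑ i, |v i| * ε n) :
    ∃ p : ℕ → ℕ → ℕ, Computable₂ p ∧
      ∀ c k, |(ratOfCode (p c k) : ℝ) - P (ratVecOfCode m c)| < (1 / 2 : ℝ) ^ k := by
  obtain ⟨gh, hgh, hghd⟩ := hh.exists_computable
  obtain ⟨gR, hgR, hgRd⟩ := hR.exists_computable
  obtain ⟨ψ, hψ, hψd⟩ := hε
  have hl : Computable fun a : ℕ × ℕ => a.2 + 3 + m * a.1 :=
    (Primrec.nat_add.comp (Primrec.nat_add.comp Primrec.snd (Primrec.const 3))
      (Primrec.nat_mul.comp (Primrec.const m) Primrec.fst)).to_comp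
  -- Smallness of the real number `ε n` is not decidable, so a rational approximation is tested.
  -- With `l` the precision, the test succeeds once `ε n < 2⁻ˡ`, and success guarantees `ε n < 3 *
  -- 2⁻ˡ`.
  have htest : Computable₂ fun (a : ℕ × ℕ) (n : ℕ) =>
      decide (ratOfCode (ψ n (a.2 + 3 + m * a.1)) < ratOfCode (ratTwoDivPow (a.2 + 3 + m * a.1))) :=
    primrecRel_ratLt.decide.to_comp.comp (hψ.comp Computable.snd (hl.comp Computable.fst))
      (primrec_ratTwoDivPow.to_comp.comp (hl.comp Computable.fst))
  obtain ⟨g, hg, hgt⟩ := Computable.exists_find htest (by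
    intro a
    have hpos : (0 : ℝ) < (1 / 2 : ℝ) ^ (a.2 + 3 + m * a.1) := by positivity
    obtain ⟨n, hn⟩ := (hε0.eventually (gt_mem_nhds hpos)).exists
    refine ⟨n, decide_eq_true ?_⟩
    rw [← Rat.cast_lt (K := ℝ), ratOfCode_ratTwoDivPow]
    have h1 : |ε n - ratOfCode (ψ n (a.2 + 3 + m * a.1))| < (1 / 2 : ℝ) ^ (a.2 + 3 + m * a.1) :=
      hψd n (a.2 + 3 + m * a.1)
    push_cast
    linarith [(abs_lt.1 h1).1])
  refine ⟨fun c k => ratAdd (gh (c, g (c, k), k + 2))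
    (ratDot m c (gR (c, g (c, k), k + 3 + m * c))), ?_, fun c k => ?_⟩
  · have hk : Computable fun a : ℕ × ℕ => a.2 + 2 :=
      (Primrec.nat_add.comp Primrec.snd (Primrec.const 2)).to_comp
    exact primrec₂_ratAdd.to_comp.comp (hgh.comp (Computable.fst.pair (hg.pair hk)))
      ((primrec₂_ratDot m).to_comp.comp Computable.fst
        (hgR.comp (Computable.fst.pair (hg.pair hl))))
  · set n := g (c, k)
    set l := k + 3 + m * c with hldef
    set v := ratVecOfCode m c
    have hlt := of_decide_eq_true (hgt (c, k))
    rw [← Rat.cast_lt (K := ℝ), ratOfCode_ratTwoDivPow] at hlt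
    push_cast at hlt
    have h1 : |ε n - ratOfCode (ψ n l)| < (1 / 2 : ℝ) ^ l := hψd n l
    have hεn : ε n ≤ 3 * (1 / 2 : ℝ) ^ l := by
      change (ratOfCode (ψ n l) : ℝ) < 2 * (1 / 2 : ℝ) ^ l at hlt
      linarith [(abs_lt.1 h1).2]
    have hml : ((m * c : ℕ) : ℝ) * (1 / 2 : ℝ) ^ l ≤ (1 / 2 : ℝ) ^ (k + 3) := by
      rw [hldef, pow_add _ (k + 3)]
      have := mul_le_mul_of_nonneg_left (two_pow_mul_le_one (m * c))
        (by positivity : (0 : ℝ) ≤ (1 / 2 : ℝ) ^ (k + 3))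
      linarith
    have h2 : ∑ i, |v i| * ε n ≤ 3 * (1 / 2 : ℝ) ^ (k + 3) := by
      have h3 (i : Fin m) (_ : i ∈ Finset.univ) : |v i| * ε n ≤ c * (3 * (1 / 2 : ℝ) ^ l) :=
        (mul_le_mul_of_nonneg_left hεn (abs_nonneg _)).trans
          (mul_le_mul_of_nonneg_right (abs_ratVecOfCode_le m c i) (by positivity))
      refine (Finset.sum_le_sum h3).trans ?_
      rw [Finset.sum_const, Finset.card_univ, Fintype.card_fin, nsmul_eq_mul]
      push_cast at hml
      linarith
    have h4 := (hP n v).trans h2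
    have h5 : |(ratOfCode (gh (c, n, k + 2)) : ℝ) - h n v| < (1 / 2 : ℝ) ^ (k + 2) :=
      hghd c n (k + 2)
    have h6 := (abs_ratDot_sub_le le_rfl
      (by rw [dist_comm]; exact (hgRd c n l).le :
        dist (R n v) (ratVecOfCode m (gR (c, n, l))) ≤ (1 / 2 : ℝ) ^ l) (c := c)).trans hml
    change |(ratOfCode (ratDot m c (gR (c, n, l))) : ℝ) - ∑ i, v i * R n v i| ≤ _ at h6
    -- In units of `2⁻ᵏ` the errors are `3/8` from `ε n`, `1/4` from the entropy and `1/8` from the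
    -- dot product.
    rw [ratOfCode_ratAdd, Rat.cast_add]
    have e2 : (1 / 2 : ℝ) ^ (k + 2) = (1 / 2) ^ k / 4 := by ring
    have e3 : (1 / 2 : ℝ) ^ (k + 3) = (1 / 2) ^ k / 8 := by ring
    have e0 : (0 : ℝ) < (1 / 2) ^ k := by positivity
    rw [e2] at h5
    rw [e3] at h4 h6
    rw [abs_lt] at h5 ⊢
    rw [abs_le] at h4 h6
    constructor <;> linarith [h4.1, h4.2, h5.1, h5.2, h6.1, h6.2]

/-! ### Computing a minimum over a ball of computable radius -/

/-- Rational points whose names are explicitly bounded form a grid. -/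
theorem exists_ratVecOfCode_grid {m : ℕ} (v : EuclideanSpace ℝ (Fin m)) (R D : ℕ)
    (hv : ∀ i, |v i| ≤ R) :
    ∃ c ≤ constTuple m (ratCode ((D + 1) * R + 1) ((D + 1) * R + 1) D),
      ∀ i, |ratVecOfCode m c i - v i| ≤ 1 / (D + 1 : ℝ) := by
  set A := (D + 1) * R + 1 with hA
  have hD : (0 : ℝ) < D + 1 := by positivity
  have hz (i : Fin m) : |⌊v i * (D + 1)⌋| ≤ A := by
    have h0 := abs_le.1 (hv i)
    have h1 : -((D + 1) * R : ℝ) ≤ v i * (D + 1) := by nlinarith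
    have h2 : v i * (D + 1) ≤ ((D + 1) * R : ℝ) := by nlinarith
    rw [abs_le]
    constructor
    · rw [Int.le_floor, hA]
      push_cast
      linarith
    · have := Int.floor_le (v i * (D + 1))
      have h3 : ((⌊v i * (D + 1)⌋ : ℤ) : ℝ) ≤ ((A : ℕ) : ℤ) := by
        rw [hA]
        push_cast
        linarith
      exact_mod_cast h3
  obtain ⟨c, hc, hci⟩ := exists_tupleEntry_le_constTuple m (ratCode A A D)
    (fun i => if hi : i < m then
      ratCode ⌊v ⟨i, hi⟩ * (D + 1)⌋.toNat (-⌊v ⟨i, hi⟩ * (D + 1)⌋).toNat D else 0) (by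
    intro i
    split_ifs with hi
    · have := abs_le.1 (hz ⟨i, hi⟩)
      exact Nat.pair_le_pair (Nat.pair_le_pair (by omega) (by omega)) le_rfl
    · exact Nat.zero_le _)
  refine ⟨c, hc, fun i => ?_⟩
  have h1 : ratVecOfCode m c i = (⌊v i * (D + 1)⌋ : ℝ) / (D + 1) := by
    have : ((⌊v i * (D + 1)⌋.toNat : ℤ) - ((-⌊v i * (D + 1)⌋).toNat : ℤ)) = ⌊v i * (D + 1)⌋ := by
      omega
    have h' : ((⌊v i * (D + 1)⌋.toNat : ℝ) - ((-⌊v i * (D + 1)⌋).toNat : ℝ)) =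
        (⌊v i * (D + 1)⌋ : ℝ) := by exact_mod_cast this
    simp only [ratVecOfCode]
    rw [hci i i.2, dif_pos i.2, ratOfCode_ratCode]
    push_cast
    rw [h']
  have h2 : ratVecOfCode m c i - v i = (⌊v i * (D + 1)⌋ - v i * (D + 1)) / (D + 1) := by
    rw [h1]
    field_simp
  rw [h2, abs_div, abs_of_pos hD]
  refine div_le_div_of_nonneg_right (abs_le.2 ⟨?_, ?_⟩) hD.le
  · linarith [Int.lt_floor_add_one (v i * (D + 1))]
  · linarith [Int.floor_le (v i * (D + 1))]

/-- From a computable positive function one computes, uniformly, an exponent `i` such that `2⁻ⁱ` is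
a strict lower bound. -/
theorem IsComputableOn.exists_code_lower_bound {X : Type*} [MetricSpace X]
    [ComputableMetricSpace X] {S : Set X} {r : X → ℝ} (hr : IsComputableOn S r)
    (hr0 : ∀ w ∈ S, 0 < r w) : ∃ e : OracleCode, ∀ w ∈ S, ∀ φ, IsOracleFor φ w → ∀ k : ℕ,
      ∃ i, e.eval φ k = Part.some i ∧ (1 / 2 : ℝ) ^ i < r w := by
  obtain ⟨cr, hcr⟩ := hr
  obtain ⟨ct, hct⟩ := OracleCode.exists_eval_eq_of_computable (g := fun z =>
    if ratOfCode (ratTwoDivPow z.unpair.2) < ratOfCode z.unpair.1 then 0 else 1)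
    (Primrec.ite (primrecRel_ratLt.comp (primrec_ratTwoDivPow.comp Primrec.unpairSnd)
      Primrec.unpairFst) (Primrec.const 0) (Primrec.const 1)).to_comp
  -- The search seeks `i` with `2 * 2⁻ⁱ < q i`, where `q i` is within `2⁻ⁱ` of `r w`; then `2⁻ⁱ < r
  -- w`. It stops at the latest when `2⁻ⁱ < r w / 3`. The value `0` of `ct` signals success.
  refine ⟨.rfind (.comp ct (.pair (.comp cr .right) .right)), fun w hw φ hφ k => ?_⟩
  choose q hq hqd using hcr w hw φ hφ
  have hqd' (i : ℕ) : |(ratOfCode (q i) : ℝ) - r w| < (1 / 2 : ℝ) ^ i := hqd i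
  have hev (i : ℕ) : cr.eval φ i = Part.some (q i) := Part.eq_some_iff.2 (hq i)
  have hfun (i : ℕ) : (fun m => decide (m = 0)) <$>
      (OracleCode.comp ct (.pair (.comp cr .right) .right)).eval φ (Nat.pair k i) =
      Part.some (decide (ratOfCode (ratTwoDivPow i) < ratOfCode (q i))) := by
    have h1 : (OracleCode.comp cr .right).eval φ (Nat.pair k i) = Part.some (q i) := by
      rw [OracleCode.eval_comp_of_eq (x := i) (by simp [OracleCode.eval]), hev]
    rw [OracleCode.eval_comp_of_eq (OracleCode.eval_pair_of_eq (y := i) h1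
      (by simp [OracleCode.eval])), hct, Nat.unpair_pair]
    by_cases h : ratOfCode (ratTwoDivPow i) < ratOfCode (q i) <;> simp [h]
  obtain ⟨n, hn⟩ := exists_pow_lt_of_lt_one (show 0 < r w / 3 by linarith [hr0 w hw])
    (by norm_num : (1 / 2 : ℝ) < 1)
  have hlt : ratOfCode (ratTwoDivPow n) < ratOfCode (q n) := by
    rw [← Rat.cast_lt (K := ℝ), ratOfCode_ratTwoDivPow]
    push_cast
    linarith [(abs_lt.1 (hqd' n)).1]
  obtain ⟨i, hi, -⟩ := Nat.rfind_min'
    (p := fun i => decide (ratOfCode (ratTwoDivPow i) < ratOfCode (q i))) (decide_eq_true hlt)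
  refine ⟨i, ?_, ?_⟩
  · refine Part.eq_some_iff.2 ?_
    have h1 : OracleCode.eval φ (.rfind (.comp ct (.pair (.comp cr .right) .right))) k =
        Nat.rfind fun i =>
          Part.some (decide (ratOfCode (ratTwoDivPow i) < ratOfCode (q i))) :=
      congrArg Nat.rfind (funext hfun)
    rw [h1]
    exact hi
  · have h1 := Nat.rfind_spec hi
    have h2 : ratOfCode (ratTwoDivPow i) < ratOfCode (q i) := by simpa using h1
    rw [← Rat.cast_lt (K := ℝ), ratOfCode_ratTwoDivPow] at h2
    push_cast at h2
    linarith [(abs_lt.1 (hqd' i)).2]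

/-- The infimum of `P v - v · w` over `v` is computable in `w` when it is attained in a ball of
computable radius and `P` is computable on rational points and Lipschitz. -/
theorem isComputableOn_of_isMin {m : ℕ} {S : Set (EuclideanSpace ℝ (Fin m))}
    {H P r : EuclideanSpace ℝ (Fin m) → ℝ} {p : ℕ → ℕ → ℕ} (hp : Computable₂ p)
    (hpP : ∀ c k, |(ratOfCode (p c k) : ℝ) - P (ratVecOfCode m c)| < (1 / 2 : ℝ) ^ k)
    (hr : IsComputableOn S r) (hr0 : ∀ w ∈ S, 0 < r w) (K B : ℕ)
    (hle : ∀ w ∈ S, ∀ v, H w ≤ P v - ∑ i, v i * w i)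
    (hmin : ∀ w ∈ S, ∀ s, 0 < s → s < r w →
      ∃ v, P v - ∑ i, v i * w i ≤ H w ∧ s * ‖v‖ ≤ B)
    (hlip : ∀ w ∈ S, ∀ v v',
      P v' - ∑ i, v' i * w i ≤ P v - ∑ i, v i * w i + ∑ i, |v' i - v i| * K) :
    IsComputableOn S H := by
  obtain ⟨e, he⟩ := hr.exists_code_lower_bound hr0
  -- Here `y` encodes the precision `k` and an `i` with `2⁻ⁱ < r w`. The mesh `1 / (D + 1)` costs at
  -- most `2⁻ᵏ / 4` by the Lipschitz bound, `A` bounds the numerators needed for `‖v‖ ≤ B * 2ⁱ`, `N`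
  -- bounds the names of grid points, and `J` is the precision for `w` that absorbs the factor `m *
  -- N`.
  set D : ℕ → ℕ := fun y => 2 ^ (y.unpair.1 + 2) * (m * K) with hD
  set A : ℕ → ℕ := fun y => (D y + 1) * (B * 2 ^ y.unpair.2) + 1 with hA
  set N : ℕ → ℕ := fun y => constTuple m (ratCode (A y) (A y) (D y)) with hN
  set J : ℕ → ℕ := fun y => y.unpair.1 + 3 + m * N y with hJ
  set s : ℕ → ℕ → ℕ := fun z c =>
    ratSub (p c (z.unpair.1.unpair.1 + 3)) (ratDot m c z.unpair.2) with hs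
  have hDp : Primrec D := Primrec.nat_mul.comp (Primrec₂.natPow.comp (Primrec.const 2)
    (Primrec.nat_add.comp Primrec.unpairFst (Primrec.const 2))) (Primrec.const _)
  have hAp : Primrec A := Primrec.nat_add.comp (Primrec.nat_mul.comp
    (Primrec.nat_add.comp hDp (Primrec.const 1)) (Primrec.nat_mul.comp (Primrec.const B)
      (Primrec₂.natPow.comp (Primrec.const 2) Primrec.unpairSnd))) (Primrec.const 1)
  have hNp : Primrec N := (primrec_constTuple m).comp ((hAp.natPair hAp).natPair hDp)
  have hJp : Primrec J := Primrec.nat_add.comp (Primrec.nat_add.comp Primrec.unpairFst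
    (Primrec.const 3)) (Primrec.nat_mul.comp (Primrec.const m) hNp)
  have hsc : Computable₂ s := primrec₂_ratSub.to_comp.comp
    (hp.comp Computable.snd (Primrec.nat_add.comp (Primrec.unpairFst.comp
      (Primrec.unpairFst.comp Primrec.fst)) (Primrec.const 3)).to_comp)
    ((primrec₂_ratDot m).to_comp.comp Computable.snd
      (Primrec.unpairSnd.to_comp.comp Computable.fst))
  obtain ⟨ci, hci⟩ := OracleCode.exists_eval_eq_of_computable Computable.id
  obtain ⟨cJ, hcJ⟩ := OracleCode.exists_eval_eq_of_computable hJp.to_comp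
  obtain ⟨cG, hcG⟩ := OracleCode.exists_eval_eq_of_computable
    (computable_ratMin hsc (hNp.to_comp.comp Primrec.unpairFst.to_comp))
  -- Once `i` is known, a single query at `J y` yields a rational `w'`; the query-free code `cG`
  -- then minimizes over all names up to `N y`.
  refine ⟨.comp cG (.pair (.pair ci e) (.comp .query (.comp cJ (.pair ci e)))),
    fun w hw φ hφ k => ?_⟩
  obtain ⟨i, hi, hir⟩ := he w hw φ hφ k
  set y := Nat.pair k i with hy
  set w' := φ (J y) with hw'
  refine ⟨ratMin (s (Nat.pair y w')) (N y), ?_, ?_⟩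
  · refine Part.eq_some_iff.1 ?_
    have h1 : (OracleCode.pair ci e).eval φ k = Part.some y :=
      OracleCode.eval_pair_of_eq (hci φ k) hi
    have h2 : (OracleCode.comp .query (.comp cJ (.pair ci e))).eval φ k = Part.some w' :=
      OracleCode.eval_comp_of_eq ((OracleCode.eval_comp_of_eq h1).trans (hcJ φ y))
    rw [OracleCode.eval_comp_of_eq (OracleCode.eval_pair_of_eq h1 h2), hcG, Nat.unpair_pair]
  have hsv (c : ℕ) : s (Nat.pair y w') c = ratSub (p c (k + 3)) (ratDot m c w') := by
    simp [hs, hy]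
  have hww : dist w (ratVecOfCode m w') ≤ (1 / 2 : ℝ) ^ (J y) := (hφ (J y)).le
  have hJy : J y = (k + 3) + m * N y := by simp [hJ, hy]
  have hmN : ((m * N y : ℕ) : ℝ) * (1 / 2 : ℝ) ^ (J y) ≤ (1 / 2 : ℝ) ^ (k + 3) := by
    rw [hJy, pow_add _ (k + 3)]
    have := mul_le_mul_of_nonneg_left (two_pow_mul_le_one (m * N y))
      (by positivity : (0 : ℝ) ≤ (1 / 2 : ℝ) ^ (k + 3))
    linarith
  have e3 : (1 / 2 : ℝ) ^ (k + 3) = (1 / 2) ^ k / 8 := by ring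
  have e0 : (0 : ℝ) < (1 / 2) ^ k := by positivity
  have happ (c : ℕ) (hc : c ≤ N y) : |(ratOfCode (s (Nat.pair y w') c) : ℝ) -
      (P (ratVecOfCode m c) - ∑ i, ratVecOfCode m c i * w i)| < (1 / 2) ^ k / 4 := by
    have h1 := (abs_ratDot_sub_le hc hww).trans hmN
    have h2 := hpP c (k + 3)
    rw [hsv, ratOfCode_ratSub, Rat.cast_sub]
    rw [e3] at h1 h2
    rw [abs_lt] at h2 ⊢
    rw [abs_le] at h1
    constructor <;> linarith [h1.1, h1.2, h2.1, h2.2]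
  obtain ⟨v, hv, hvB⟩ := hmin w hw _ (by positivity) hir
  have hvR (j : Fin m) : |v j| ≤ ((B * 2 ^ i : ℕ) : ℝ) := by
    have h1 : |v j| ≤ ‖v‖ := PiLp.norm_apply_le v j
    refine h1.trans ?_
    have h2 : (2 : ℝ) ^ i * ((1 / 2) ^ i * ‖v‖) ≤ 2 ^ i * B :=
      mul_le_mul_of_nonneg_left hvB (by positivity)
    rw [← mul_assoc, ← mul_pow] at h2
    norm_num at h2
    push_cast
    linarith
  obtain ⟨c₀, hc₀, hc₀v⟩ := exists_ratVecOfCode_grid v (B * 2 ^ i) (D y) hvR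
  have hc₀N : c₀ ≤ N y := by simpa [hN, hA, hy] using hc₀
  have hup : (ratOfCode (ratMin (s (Nat.pair y w')) (N y)) : ℝ) ≤
      ratOfCode (s (Nat.pair y w') c₀) := by
    exact_mod_cast ratOfCode_ratMin_le _ hc₀N
  obtain ⟨c₁, hc₁, hc₁e⟩ := exists_ratMin_eq (s (Nat.pair y w')) (N y)
  have hgrid : ∑ j, |ratVecOfCode m c₀ j - v j| * (K : ℝ) ≤ (1 / 2) ^ k / 4 := by
    have h1 (j : Fin m) (_ : j ∈ Finset.univ) :
        |ratVecOfCode m c₀ j - v j| * (K : ℝ) ≤ 1 / (D y + 1) * K :=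
      mul_le_mul_of_nonneg_right (hc₀v j) (by positivity)
    refine (Finset.sum_le_sum h1).trans ?_
    rw [Finset.sum_const, Finset.card_univ, Fintype.card_fin, nsmul_eq_mul]
    have hDy : (D y : ℝ) = 2 ^ k * 4 * (m * K) := by
      simp only [hD, hy, Nat.unpair_pair]
      push_cast
      ring
    have h2 : (m : ℝ) * (1 / (D y + 1) * K) = (m * K) / (D y + 1) := by ring
    rw [h2, div_le_iff₀ (by positivity), hDy]
    have h3 : (1 / 2 : ℝ) ^ k * 2 ^ k = 1 := by rw [← mul_pow]; norm_num
    have h4 : (1 / 2 : ℝ) ^ k / 4 * (2 ^ k * 4 * (m * K) + 1) =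
        (1 / 2 : ℝ) ^ k * 2 ^ k * (m * K) + (1 / 2 : ℝ) ^ k / 4 := by ring
    rw [h4, h3]
    linarith
  -- The grid point `c₀` near the true minimizer bounds the computed minimum from above, with errors
  -- `1/4 + 1/4` in units of `2⁻ᵏ`. The selected point `c₁` bounds it from below, since no `v` gives
  -- a value under `H w`.
  have h0 := abs_lt.1 (happ c₀ hc₀N)
  have h1 := abs_lt.1 (happ c₁ hc₁)
  have h2 := hlip w hw v (ratVecOfCode m c₀)
  have h3 := hle w hw (ratVecOfCode m c₁)
  change |(ratOfCode (ratMin (s (Nat.pair y w')) (N y)) : ℝ) - H w| < (1 / 2) ^ k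
  rw [abs_lt]
  constructor
  · rw [hc₁e]
    linarith [h1.1]
  · linarith [h0.2]

/-! ### Rotation vectors -/

theorem rotationVector_apply {X : Type*} [MetricSpace X] [MeasurableSpace X] {m : ℕ}
    (Φ : C(X, EuclideanSpace ℝ (Fin m))) (μ : Measure X) (i : Fin m) :
    rotationVector Φ μ i = ∫ x, Φ x i ∂μ := rfl

section RotationVector

variable {X : Type*} [MetricSpace X] [CompactSpace X] [MeasurableSpace X] [BorelSpace X] {m : ℕ}

theorem integrable_coord (Φ : C(X, EuclideanSpace ℝ (Fin m))) (μ : Measure X) [IsFiniteMeasure μ]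
    (i : Fin m) : Integrable (fun x => Φ x i) μ := by
  have h : Continuous fun x => Φ x i := by fun_prop
  exact h.integrable_of_hasCompactSupport (HasCompactSupport.of_compactSpace _)

theorem abs_rotationVector_sub_le (Φ Ψ : C(X, EuclideanSpace ℝ (Fin m))) (μ : Measure X)
    [IsProbabilityMeasure μ] (i : Fin m) :
    |rotationVector Φ μ i - rotationVector Ψ μ i| ≤ ‖Φ - Ψ‖ := by
  rw [rotationVector_apply, rotationVector_apply,
    ← integral_sub (integrable_coord Φ μ i) (integrable_coord Ψ μ i), ← Real.norm_eq_abs]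
  refine (norm_integral_le_of_norm_le_const (C := ‖Φ - Ψ‖) (Eventually.of_forall fun x => ?_)).trans
    (by simp)
  exact (PiLp.norm_apply_le ((Φ - Ψ) x) i).trans ((Φ - Ψ).norm_coe_le_norm x)

theorem abs_rotationVector_le (Φ : C(X, EuclideanSpace ℝ (Fin m))) (μ : Measure X)
    [IsProbabilityMeasure μ] (i : Fin m) : |rotationVector Φ μ i| ≤ ‖Φ‖ := by
  simpa [rotationVector_apply] using abs_rotationVector_sub_le Φ 0 μ i

theorem integral_dotPotential (v : EuclideanSpace ℝ (Fin m)) (Φ : C(X, EuclideanSpace ℝ (Fin m)))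
    (μ : Measure X) [IsFiniteMeasure μ] :
    ∫ x, dotPotential v Φ x ∂μ = ∑ i, v i * rotationVector Φ μ i := by
  unfold dotPotential
  rw [integral_finsetSum _ fun i _ => (integrable_coord Φ μ i).const_mul _]
  simp only [integral_const_mul, rotationVector_apply]

theorem rotationVector_convexCombination (Φ : C(X, EuclideanSpace ℝ (Fin m))) {μ ν ρ : Measure X}
    [IsFiniteMeasure μ] [IsFiniteMeasure ν] {a b : ℝ} (ha : 0 ≤ a) (hb : 0 ≤ b)
    (hρ : ρ = ENNReal.ofReal a • μ + ENNReal.ofReal b • ν) :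
    rotationVector Φ ρ = a • rotationVector Φ μ + b • rotationVector Φ ν := by
  ext i
  rw [PiLp.add_apply, PiLp.smul_apply, PiLp.smul_apply, rotationVector_apply, rotationVector_apply,
    rotationVector_apply, hρ, integral_add_measure
      ((integrable_coord Φ μ i).smul_measure ENNReal.ofReal_ne_top)
      ((integrable_coord Φ ν i).smul_measure ENNReal.ofReal_ne_top), integral_smul_measure,
    integral_smul_measure, ENNReal.toReal_ofReal ha, ENNReal.toReal_ofReal hb]

end RotationVector

/-! ### Estimates for the pairing, and the main theorem -/

theorem sum_mul_sub_sum_mul_le {m : ℕ} {v v' x y : EuclideanSpace ℝ (Fin m)} {K : ℝ}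
    (h : ∀ i, |x i - y i| ≤ K) : ∑ i, v' i * x i - ∑ i, v' i * y i ≤
      ∑ i, v i * x i - ∑ i, v i * y i + ∑ i, |v' i - v i| * K := by
  rw [← Finset.sum_sub_distrib, ← Finset.sum_sub_distrib, ← Finset.sum_add_distrib]
  refine Finset.sum_le_sum fun i _ => ?_
  have h1 : (v' i - v i) * (x i - y i) ≤ |v' i - v i| * K :=
    (le_abs_self _).trans (by rw [abs_mul]; exact mul_le_mul_of_nonneg_left (h i) (abs_nonneg _))
  linarith

theorem abs_sum_mul_sub_sum_mul_le {m : ℕ} {v x y : EuclideanSpace ℝ (Fin m)} {δ : ℝ}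
    (h : ∀ i, |x i - y i| ≤ δ) : |∑ i, v i * x i - ∑ i, v i * y i| ≤ ∑ i, |v i| * δ := by
  rw [← Finset.sum_sub_distrib]
  refine (Finset.abs_sum_le_sum_abs _ _).trans (Finset.sum_le_sum fun i _ => ?_)
  rw [← mul_sub, abs_mul]
  exact mul_le_mul_of_nonneg_left (h i) (abs_nonneg _)

theorem inner_eq_sum_mul {m : ℕ} (v x : EuclideanSpace ℝ (Fin m)) :
    inner ℝ v x = ∑ i, v i * x i := by
  simp [PiLp.inner_apply, mul_comm]

theorem theoremC {X : Type*} [MetricSpace X] [CompactSpace X] [MeasurableSpace X] [BorelSpace X]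
    [ComputableMetricSpace X]
    (f : X → X) (hf : Continuous f)
    (husc : UpperSemicontinuous fun μ : InvariantMeasure f => metricEntropy f (μ.1 : Measure X))
    {m : ℕ} (Φ : C(X, EuclideanSpace ℝ (Fin m))) (hΦ : IsComputableOn univ (Φ : X → _))
    (r : EuclideanSpace ℝ (Fin m) → ℝ)
    (hr : ∀ w ∈ interior (rotationSet f Φ), 0 < r w ∧ Metric.ball w (r w) ⊆ rotationSet f Φ)
    (hrc : IsComputableOn (interior (rotationSet f Φ)) r)
    (Φs : ℕ → C(X, EuclideanSpace ℝ (Fin m))) (ε : ℕ → ℝ)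
    (happ : IsApproximatingSequence Φ Φs ε)
    (μ : ℕ → EuclideanSpace ℝ (Fin m) → InvariantMeasure f)
    (hμ : ∀ n v (ν : InvariantMeasure f),
      IsEquilibriumState f (dotPotential v (Φs n)) ν ↔ ν = μ n v)
    (hε : IsComputablePointSeq ε)
    (h : ℕ → EuclideanSpace ℝ (Fin m) → ℝ)
    (hh : ∀ n v, metricEntropy f ((μ n v).1 : Measure X) = (h n v : EReal))
    (hhc : IsComputableFunSeq h)
    (hrv : IsComputableFunSeq fun n v => rotationVector (Φs n) ((μ n v).1 : Measure X)) :
    ∃ H : EuclideanSpace ℝ (Fin m) → ℝ,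
      (∀ w ∈ interior (rotationSet f Φ), localizedEntropy f Φ w = (H w : EReal)) ∧
      IsComputableOn (interior (rotationSet f Φ)) H := by
  set η : InvariantMeasure f → ℝ := fun ν => (metricEntropy f (ν.1 : Measure X)).toReal with hη
  set x : InvariantMeasure f → EuclideanSpace ℝ (Fin m) :=
    fun ν => rotationVector Φ (ν.1 : Measure X) with hx
  have hvar (n : ℕ) (v : EuclideanSpace ℝ (Fin m)) (ν : InvariantMeasure f) :
      metricEntropy f (ν.1 : Measure X) +
        ((∑ i, v i * rotationVector (Φs n) (ν.1 : Measure X) i : ℝ) : EReal) ≤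
      ((h n v + ∑ i, v i * rotationVector (Φs n) ((μ n v).1 : Measure X) i : ℝ) : EReal) := by
    have h1 := (hμ n v (μ n v)).2 rfl
    rw [IsEquilibriumState, hh, integral_dotPotential, ← EReal.coe_add] at h1
    rw [h1, ← integral_dotPotential]
    exact le_iSup (fun ν : InvariantMeasure f => metricEntropy f (ν.1 : Measure X) +
      ((∫ x, dotPotential v (Φs n) x ∂(ν.1 : Measure X) : ℝ) : EReal)) ν
  -- For `v = 0` the potential vanishes, so its equilibrium state has maximal entropy. This makes
  -- all entropies finite.
  have hB (ν : InvariantMeasure f) : metricEntropy f (ν.1 : Measure X) ≤ (h 0 0 : EReal) := by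
    simpa using hvar 0 0 ν
  have hηc (ν : InvariantMeasure f) : metricEntropy f (ν.1 : Measure X) = (η ν : EReal) :=
    (EReal.coe_toReal (ne_top_of_le_ne_top (EReal.coe_ne_top _) (hB ν))
      (ne_bot_of_le_ne_bot (by simp) (metricEntropy_nonneg f _))).symm
  have hη0 (ν : InvariantMeasure f) : 0 ≤ η ν := EReal.toReal_nonneg (metricEntropy_nonneg f _)
  have hηB (ν : InvariantMeasure f) : η ν ≤ h 0 0 := by
    have := hB ν
    rwa [hηc, EReal.coe_le_coe_iff] at this
  have hηh (n : ℕ) (v : EuclideanSpace ℝ (Fin m)) : η (μ n v) = h n v := by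
    simp only [hη, hh, EReal.toReal_coe]
  have hvar' (n : ℕ) (v : EuclideanSpace ℝ (Fin m)) (ν : InvariantMeasure f) :
      η ν + ∑ i, v i * rotationVector (Φs n) (ν.1 : Measure X) i ≤
        h n v + ∑ i, v i * rotationVector (Φs n) ((μ n v).1 : Measure X) i := by
    have := hvar n v ν
    rwa [hηc, ← EReal.coe_add, EReal.coe_le_coe_iff] at this
  have herr (n : ℕ) (v : EuclideanSpace ℝ (Fin m)) (ν : InvariantMeasure f) :
      |∑ i, v i * rotationVector (Φs n) (ν.1 : Measure X) i - ∑ i, v i * x ν i| ≤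
        ∑ i, |v i| * ε n :=
    abs_sum_mul_sub_sum_mul_le fun i =>
      (abs_rotationVector_sub_le (Φs n) Φ (ν.1 : Measure X) i).trans (happ.2 n).le
  have hne : Nonempty (InvariantMeasure f) := ⟨μ 0 0⟩
  set P : EuclideanSpace ℝ (Fin m) → ℝ := fun v => ⨆ ν, (η ν + ∑ i, v i * x ν i) with hP
  have hbdd (v : EuclideanSpace ℝ (Fin m)) : BddAbove (range fun ν => η ν + ∑ i, v i * x ν i) := by
    refine ⟨h 0 v + ∑ i, v i * rotationVector (Φs 0) ((μ 0 v).1 : Measure X) i +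
      ∑ i, |v i| * ε 0, ?_⟩
    rintro _ ⟨ν, rfl⟩
    linarith [hvar' 0 v ν, (abs_le.1 (herr 0 v ν)).1]
  have hPle (v : EuclideanSpace ℝ (Fin m)) (ν : InvariantMeasure f) :
      η ν + ∑ i, v i * x ν i ≤ P v := le_ciSup (hbdd v) ν
  -- Both pressures are suprema over the same measures, of quantities that differ by at most the
  -- right-hand side.
  have hPapprox (n : ℕ) (v : EuclideanSpace ℝ (Fin m)) :
      |h n v + ∑ i, v i * rotationVector (Φs n) ((μ n v).1 : Measure X) i - P v| ≤
        ∑ i, |v i| * ε n := by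
    rw [abs_le]
    constructor
    · have : P v ≤ h n v + ∑ i, v i * rotationVector (Φs n) ((μ n v).1 : Measure X) i +
          ∑ i, |v i| * ε n :=
        ciSup_le fun ν => by linarith [hvar' n v ν, (abs_le.1 (herr n v ν)).1]
      linarith
    · have := hPle v (μ n v)
      rw [hηh] at this
      linarith [(abs_le.1 (herr n v (μ n v))).2]
  obtain ⟨p, hp, hpP⟩ := exists_computable_approx hhc hrv hε happ.1 hPapprox
  have hloc (w : EuclideanSpace ℝ (Fin m)) (hw : w ∈ interior (rotationSet f Φ)) :
      localizedEntropy f Φ w = ((localizedEntropy f Φ w).toReal : EReal) := by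
    obtain ⟨ν, hν⟩ := interior_subset hw
    have h1 : localizedEntropy f Φ w ≤ (h 0 0 : EReal) := iSup₂_le fun ν _ => hB ν
    have h2 : 0 ≤ localizedEntropy f Φ w := (metricEntropy_nonneg f (ν.1 : Measure X)).trans
      (le_iSup₂ (f := fun (ν : InvariantMeasure f)
        (_ : rotationVector Φ (ν.1 : Measure X) = w) => metricEntropy f (ν.1 : Measure X)) ν hν)
    exact (EReal.coe_toReal (ne_top_of_le_ne_top (EReal.coe_ne_top _) h1)
      (ne_bot_of_le_ne_bot (by simp) h2)).symm
  set H : EuclideanSpace ℝ (Fin m) → ℝ := fun w => (localizedEntropy f Φ w).toReal with hH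
  have hlub (w : EuclideanSpace ℝ (Fin m)) (hw : w ∈ interior (rotationSet f Φ)) :
      IsLUB {t | ∃ ν, x ν = w ∧ t = η ν} (H w) := by
    constructor
    · rintro _ ⟨ν, hν, rfl⟩
      rw [← EReal.coe_le_coe_iff, ← hηc, ← hloc w hw]
      exact le_iSup₂ (f := fun (ν : InvariantMeasure f)
        (_ : rotationVector Φ (ν.1 : Measure X) = w) => metricEntropy f (ν.1 : Measure X)) ν hν
    · intro b hb
      rw [← EReal.coe_le_coe_iff, ← hloc w hw]
      refine iSup₂_le fun ν hν => ?_
      rw [hηc, EReal.coe_le_coe_iff]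
      exact hb ⟨ν, hν, rfl⟩
  -- Two rotation vectors differ in each coordinate by at most `2 * ‖Φ‖`, which gives the Lipschitz
  -- constant of `P v - v · w`.
  obtain ⟨K, hK⟩ := exists_nat_ge (2 * ‖Φ‖)
  obtain ⟨B, hBn⟩ := exists_nat_ge (h 0 0)
  refine ⟨H, hloc, isComputableOn_of_isMin hp hpP hrc (fun w hw => (hr w hw).1) K B ?_ ?_ ?_⟩
  · intro w hw v
    refine (hlub w hw).2 ?_
    rintro _ ⟨ν, rfl, rfl⟩
    linarith [hPle v ν]
  · intro w hw s hs hsr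
    obtain ⟨v, hv⟩ := exists_supporting_vector x η hη0 (fun i j a b ha hb hab => by
      obtain ⟨ρ, hρ, hρη⟩ := InvariantMeasure.exists_metricEntropy_concave i j ha hb hab hB
      exact ⟨ρ, rotationVector_convexCombination Φ ha hb hρ, hρη⟩) hw (hlub w hw)
    have hball : Metric.closedBall w s ⊆ range x :=
      (Metric.closedBall_subset_ball hsr).trans (hr w hw).2
    refine ⟨v, ?_, (norm_supporting_vector_le hη0 hs hball hv).trans ?_⟩
    -- The supporting inequality, taken over all `ν`, says exactly that `v` attains the minimum in
    -- the duality formula.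
    · have : P v ≤ H w + ∑ i, v i * w i := ciSup_le fun ν => by
        have := hv ν
        rw [inner_sub_right, inner_eq_sum_mul, inner_eq_sum_mul] at this
        linarith
      linarith
    · refine ((hlub w hw).2 ?_).trans hBn
      rintro _ ⟨ν, -, rfl⟩
      exact hηB ν
  · intro w hw v v'
    obtain ⟨ν₀, hν₀⟩ := interior_subset hw
    have : P v' ≤ P v - ∑ i, v i * w i + ∑ i, |v' i - v i| * (K : ℝ) + ∑ i, v' i * w i := by
      refine ciSup_le fun ν => ?_
      have h1 := sum_mul_sub_sum_mul_le (v := v) (v' := v') (x := x ν) (y := w) (K := K) fun i => by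
        have h2 := abs_le.1 (abs_rotationVector_le Φ (ν.1 : Measure X) i)
        have h3 := abs_le.1 (abs_rotationVector_le Φ (ν₀.1 : Measure X) i)
        rw [← hν₀, abs_le]
        constructor <;> linarith [h2.1, h2.2, h3.1, h3.2]
      linarith [hPle v ν]
    linarith
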